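/- **Setting.** Let $\kappa\colon[0,\infty)\to[1,\infty)$ be a sublinear function, meaning: non-decreasing, concave, and $\kappa(t)/t\to 0$ as $t\to\infty$. Let $X$ be a proper CAT(0) space with a base-point $\mathfrak o$; write $\|x\|=d(\mathfrak o,x)$ and $\kappa(x)=\kappa(\|x\|)$. For $q\ge 1$, $Q\ge 0$, a map $f$ between metric spaces is a $(q,Q)$-quasi-isometric embedding if $\frac1q d(x,y)-Q\le d(f(x),f(y))\le q\,d(x,y)+Q$ for all $x,y$, and a $(q,Q)$-quasi-isometry if moreover every point of the target is within $Q$ of the image. A $(q,Q)$-quasi-geodesic (ray or segment) is a continuous $(q,Q)$-quasi-isometric embedding of $[0,\infty)$, respectively $[s,t]$, into $X$; all geodesic rays and quasi-geodesic rays start at $\mathfrak o$. A ray is identified with its image where a subset of $X$ is called for. For $Z\subseteq X$ let $\mathcal N_\kappa(Z,n)=\{x\in X: d(x,Z)\le n\,\kappa(x)\}$. Two quasi-geodesic rays *$\kappa$-fellow travel* if each lies in some $\mathcal N_\kappa(\cdot,n)$ of the other; this is an equivalence relation. Write $x_Z$ for the set of points of $Z$ nearest to $x$. A closed set $Z$ is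 *$\kappa$-contracting* if there is $c$ such that $d(x,y)\le d(x,Z)$ implies $\operatorname{diam}(x_Z\cup y_Z)\le c\,\kappa(x)$ for all $x,y\in X$. The set $\partial_\kappa X$ consists of the $\kappa$-fellow traveling classes of $\kappa$-contracting quasi-geodesic rays. A number $D$ is *small compared to* $r>0$ if $D\le r/(2\kappa(r))$. For a quasi-geodesic ray $\eta$ and $r>0$ let $t_r$ be the first time with $\|\eta(t_r)\|=r$, and $\eta|_r=\eta([0,t_r])$. A *strong Morse gauge* for a closed set $Z$ is a function $m(q,Q)$ with $m(q,Q)\ge\max(q,Q)$ such that 1. every $(q,Q)$-quasi-geodesic segment with end points on $Z$ lies in $\mathcal N_\kappa(Z,m(q,Q))$; 2. for all $r,n>0$ and every sublinear function $\kappa'$ there is $R>0$ such that, for every $(q,Q)$-quasi-geodesic ray $\eta$ for which $m(q,Q)$ is small compared to $r$, $d(\eta(t_R),Z)\le n\,\kappa'(R)$ implies $\eta|_r\subset\mathcal N_\kappa(Z,m(q,Q))$. Choose, for each $\mathbf b\in\partial_\kappa X$, a geodesic ray $b\in\mathbf b$ and a strong Morse gauge $m_b$ for $b$. For $r>0$ let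 $\mathcal U_\kappa(\mathbf b,r)$ be the set of all $\mathbf a\in\partial_\kappa X$ such that every $(q,Q)$-quasi-geodesic ray $\alpha\in\mathbf a$ for which $m_b(q,Q)$ is small compared to $r$ satisfies $\alpha|_r\subset\mathcal N_\kappa(b,m_b(q,Q))$. A set $W\subseteq\partial_\kappa X$ is open if for every $\mathbf b\in W$ there is $r>0$ with $\mathcal U_\kappa(\mathbf b,r)\subseteq W$. **Statement.** Let $X_1$ and $X_2$ be proper CAT(0) spaces with base-points $\mathfrak o_1,\mathfrak o_2$, and let $G$ be a group that acts on each $X_i$ by quasi-isometries whose constants do not depend on the group element, properly discontinuously ($\{g: gC\cap C\ne\emptyset\}$ is finite for every compact $C\subseteq X_i$) and co-compactly (the translates of some compact set cover $X_i$). In particular, $G$ may be any group that acts geometrically (properly discontinuously, co-compactly and by isometries) on $X_1$ and $X_2$. Then, for every sublinear function $\kappa$, geodesic rays $b\in\mathbf b$ and gauges $m_b$ as above exist for all points $\mathbf b$ of $\partial_\kappa X_1$ and of $\partial_\kappa X_2$, and for every choice of them the spaces $\partial_\kappa X_1$ and $\partial_\kappa X_2$ are homeomorphic. Hence the $\kappa$-Morse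 boundary $\partial_\kappa G$ of $G$ is well defined up to homeomorphism. -/

import Mathlib

open Set Filter Topology
open scoped NNReal

namespace SublinMorse

/-! ### Sublinear functions -/

/-- A function `κ : [0,∞) → [1,∞)` that is monotone increasing (in the weak sense, so that
constants are allowed), concave and sublinear. Values at negative reals play no role. -/
structure SublinearFunction where
  toFun : ℝ → ℝ
  one_le : ∀ t, 0 ≤ t → 1 ≤ toFun t
  mono : MonotoneOn toFun (Ici 0)
  concave : ConcaveOn ℝ (Ici 0) toFun
  sublinear : Tendsto (fun t => toFun t / t) atTop (𝓝 0)

instance : CoeFun SublinearFunction (fun _ => ℝ → ℝ) := ⟨SublinearFunction.toFun⟩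

/-- The quantity `D` is small compared to the radius `r`. -/
def SmallComparedTo (κ : SublinearFunction) (D r : ℝ) : Prop := D ≤ r / (2 * κ r)

/-! ### Geodesics, CAT(0) spaces, quasi-isometries -/

section Metric

variable {X Y : Type*} [MetricSpace X] [MetricSpace Y]

/-- `γ`, restricted to `[0, ℓ]`, is a geodesic segment of length `ℓ` from `x` to `y`. -/
structure IsGeodesicSegment (γ : ℝ → X) (ℓ : ℝ) (x y : X) : Prop where
  nonneg : 0 ≤ ℓ
  left : γ 0 = x
  right : γ ℓ = y
  isom : ∀ s ∈ Icc 0 ℓ, ∀ t ∈ Icc 0 ℓ, dist (γ s) (γ t) = |s - t|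

variable (X) in
/-- CAT(0) spaces: geodesic metric spaces whose geodesic triangles `p q r` are at least as thin as
the Euclidean triangles `p' q' r'` with the same side lengths. (The points compared lie on the two
sides issuing from `p`; since `p` is any of the three vertices, this covers all pairs of
sides.) -/
structure IsCAT0 : Prop where
  geodesic : ∀ x y : X, ∃ (γ : ℝ → X) (ℓ : ℝ), IsGeodesicSegment γ ℓ x y
  thin : ∀ (p q r : X) (γ δ : ℝ → X) (a b : ℝ),
    IsGeodesicSegment γ a p q → IsGeodesicSegment δ b p r →
    ∀ p' q' r' : EuclideanSpace ℝ (Fin 2),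
      dist p' q' = dist p q → dist p' r' = dist p r → dist q' r' = dist q r →
    ∀ s ∈ Icc 0 a, ∀ t ∈ Icc 0 b, ∀ x' ∈ segment ℝ p' q', ∀ y' ∈ segment ℝ p' r',
      dist p' x' = dist p (γ s) → dist p' y' = dist p (δ t) →
      dist (γ s) (δ t) ≤ dist x' y'

/-- `(k, K)`-quasi-isometric embeddings. -/
def IsQIEmbedding (k K : ℝ) (f : X → Y) : Prop :=
  1 ≤ k ∧ 0 ≤ K ∧ ∀ x y : X,
    1 / k * dist x y - K ≤ dist (f x) (f y) ∧ dist (f x) (f y) ≤ k * dist x y + K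

/-- `(k, K)`-quasi-isometries. -/
def IsQuasiIsometry (k K : ℝ) (f : X → Y) : Prop :=
  IsQIEmbedding k K f ∧ ∀ y : Y, ∃ x : X, dist y (f x) ≤ K

/-- The action of `G` on `X` is by quasi-isometries (with constants that do not depend on the group
element), properly discontinuous, and co-compact. Geometric actions, that is, properly
discontinuous and co-compact actions by isometries, are those where the constants can be taken to
be `k = 1` and `K = 0`. -/
structure ActsQuasiGeometrically (G : Type*) [Group G] (X : Type*) [MetricSpace X]
    [MulAction G X] : Prop where
  quasiIsometric : ∃ k K : ℝ, ∀ g : G, IsQuasiIsometry k K (fun x : X => g • x)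
  discrete : ∀ C : Set X, IsCompact C → {g : G | (((fun x => g • x) '' C) ∩ C).Nonempty}.Finite
  cocompact : ∃ C : Set X, IsCompact C ∧ ∀ x : X, ∃ g : G, ∃ c ∈ C, g • c = x

/-! ### Quasi-geodesics, neighbourhoods, the contracting and the Morse property

The base-point is `o`, and the norm of `x` is `dist o x`. -/

/-- Quasi-geodesic rays starting from the base-point: continuous quasi-isometric embeddings
`[0,∞) → X` that send `0` to `o`. -/
structure QRay (o : X) where
  toFun : ℝ≥0 → X
  continuous_toFun : Continuous toFun
  start : toFun 0 = o
  quasi : ∃ q Q : ℝ, IsQIEmbedding q Q toFun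

instance (o : X) : CoeFun (QRay o) (fun _ => ℝ≥0 → X) := ⟨QRay.toFun⟩

/-- The `(κ, n)`-neighbourhood of `Z`. -/
def kNbhd (κ : SublinearFunction) (o : X) (Z : Set X) (n : ℝ) : Set X :=
  {x | Metric.infDist x Z ≤ n * κ (dist o x)}

/-- The set of nearest points to `x` in `Z`. -/
def nearest (x : X) (Z : Set X) : Set X := {z ∈ Z | dist x z = Metric.infDist x Z}

/-- `κ`-contracting sets: if `d(x, y) ≤ d(x, Z)` then the union of the nearest-point projections of
`x` and `y` to `Z` has diameter at most `c * κ(‖x‖)`. -/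
def IsContracting (κ : SublinearFunction) (o : X) (Z : Set X) : Prop :=
  ∃ c : ℝ, ∀ x y : X, dist x y ≤ Metric.infDist x Z →
    ∀ u ∈ nearest x Z ∪ nearest y Z, ∀ v ∈ nearest x Z ∪ nearest y Z,
      dist u v ≤ c * κ (dist o x)

/-- The first time at which `η` has norm `r`. -/
noncomputable def firstTime {o : X} (η : QRay o) (r : ℝ) : ℝ≥0 :=
  sInf {t : ℝ≥0 | dist o (η t) = r}

/-- The part `η|ᵣ` of `η` up to the first time at which it has norm `r`, as a subset of `X`. -/
def initialPart {o : X} (η : QRay o) (r : ℝ) : Set X := η '' Icc 0 (firstTime η r)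

/-- `m` is a Morse gauge for `Z`: the quasi-geodesic segments with end points on `Z` stay in the
neighbourhood of `Z` that `m` prescribes. -/
structure IsMorseGauge (κ : SublinearFunction) (o : X) (Z : Set X) (m : ℝ → ℝ → ℝ) : Prop where
  max_le : ∀ q Q : ℝ, 1 ≤ q → 0 ≤ Q → max q Q ≤ m q Q
  morse : ∀ (q Q s t : ℝ) (hst : s ≤ t) (β : Icc s t → X), Continuous β → IsQIEmbedding q Q β →
    β ⟨s, left_mem_Icc.2 hst⟩ ∈ Z → β ⟨t, right_mem_Icc.2 hst⟩ ∈ Z →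
    range β ⊆ kNbhd κ o Z (m q Q)

/-- `m` is a strong Morse gauge for `Z`: moreover, for every `r`, `n`, `κ'` there is a radius `R`
such that a `(q, Q)`-quasi-geodesic ray for which `m q Q` is small compared to `r`, and which is
within `n * κ'(R)` of `Z` when it first has norm `R`, stays in the `(κ, m q Q)`-neighbourhood of `Z`
until it first has norm `r`. -/
structure IsStrongMorseGauge (κ : SublinearFunction) (o : X) (Z : Set X) (m : ℝ → ℝ → ℝ) : Prop
    extends IsMorseGauge κ o Z m where
  strong : ∀ r n : ℝ, 0 < r → 0 < n → ∀ κ' : SublinearFunction, ∃ R : ℝ, 0 < R ∧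
    ∀ (q Q : ℝ) (η : QRay o), IsQIEmbedding q Q η → SmallComparedTo κ (m q Q) r →
      Metric.infDist (η (firstTime η R)) Z ≤ n * κ' R →
      initialPart η r ⊆ kNbhd κ o Z (m q Q)

/-! ### Fellow traveling -/

/-- `β` is in some `κ`-neighbourhood of `γ`, and conversely. -/
def FellowTravel (κ : SublinearFunction) {o : X} (β γ : QRay o) : Prop :=
  (∃ n : ℝ, range β ⊆ kNbhd κ o (range γ) n) ∧ ∃ n : ℝ, range γ ⊆ kNbhd κ o (range β) n

end Metric

namespace SublinearFunction

variable (κ : SublinearFunction)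

lemma pos {t : ℝ} (ht : 0 ≤ t) : 0 < κ t := lt_of_lt_of_le one_pos (κ.one_le t ht)

lemma mul_le {a t : ℝ} (ha : 1 ≤ a) (ht : 0 ≤ t) : κ (a * t) ≤ a * κ t := by
  have ha0 : 0 < a := by linarith
  have h := κ.concave.2 (mem_Ici.2 (mul_nonneg ha0.le ht)) (mem_Ici.2 le_rfl)
    (inv_nonneg.2 ha0.le) (sub_nonneg.2 (inv_le_one_of_one_le₀ ha)) (by ring)
  simp only [smul_eq_mul, mul_zero, add_zero] at h
  rw [inv_mul_cancel_left₀ ha0.ne'] at h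
  have h0 : 0 ≤ (1 - a⁻¹) * κ.toFun 0 :=
    mul_nonneg (sub_nonneg.2 (inv_le_one_of_one_le₀ ha)) (κ.pos le_rfl).le
  have h1 : a⁻¹ * κ.toFun (a * t) ≤ κ.toFun t := by linarith
  calc κ.toFun (a * t) = a * (a⁻¹ * κ.toFun (a * t)) := by field_simp
    _ ≤ a * κ.toFun t := mul_le_mul_of_nonneg_left h1 ha0.le

lemma div_mono {r r' : ℝ} (hr : 0 < r) (h : r ≤ r') : r / (2 * κ r) ≤ r' / (2 * κ r') := by
  have h1 := κ.mul_le ((one_le_div hr).2 h) hr.le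
  rw [div_mul_cancel₀ _ hr.ne'] at h1
  have hk := κ.pos hr.le
  have hk' := κ.pos (hr.le.trans h)
  rw [div_le_div_iff₀ (by linarith) (by linarith)]
  have h2 : r * κ.toFun r' ≤ r' * κ.toFun r := by
    calc r * κ.toFun r' ≤ r * (r' / r * κ.toFun r) := mul_le_mul_of_nonneg_left h1 hr.le
      _ = r' * κ.toFun r := by field_simp
  linarith

lemma add_le {s t : ℝ} (hs : 0 ≤ s) (ht : 0 ≤ t) : κ (s + t) ≤ κ s + κ t := by
  rcases hs.eq_or_lt with rfl | hs'
  · have := κ.pos le_rfl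
    rw [zero_add]; linarith
  rcases ht.eq_or_lt with rfl | ht'
  · have := κ.pos le_rfl
    rw [add_zero]; linarith
  have h1 := κ.div_mono hs' (le_add_of_nonneg_right ht : s ≤ s + t)
  have h2 := κ.div_mono ht' (le_add_of_nonneg_left hs : t ≤ s + t)
  have p := κ.pos hs
  have p' := κ.pos ht
  have p'' := κ.pos (add_nonneg hs ht)
  rw [div_le_div_iff₀ (by linarith) (by linarith)] at h1 h2
  have : (s + t) * κ.toFun (s + t) ≤ (s + t) * (κ.toFun s + κ.toFun t) := by nlinarith
  exact le_of_mul_le_mul_left this (by linarith)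

lemma le_one_mul {t : ℝ} (ht : 1 ≤ t) : κ t ≤ κ 1 * t := by
  have := κ.mul_le ht zero_le_one
  rw [mul_one] at this
  linarith

/-- The values of `κ` at points whose distance is at most `n * κ(‖x‖)` are comparable. -/
lemma compare {X : Type*} [MetricSpace X] (o : X) {x y : X} {n : ℝ} (hn : 1 ≤ n)
    (h : dist x y ≤ n * κ (dist o x)) : κ (dist o y) ≤ (1 + n * κ 1) * κ (dist o x) := by
  have hx := κ.one_le _ (dist_nonneg (x := o) (y := x))
  have hnk : 1 ≤ n * κ.toFun (dist o x) := by nlinarith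
  have h1 : dist o y ≤ dist o x + n * κ.toFun (dist o x) :=
    (dist_triangle o x y).trans (by linarith)
  calc κ.toFun (dist o y) ≤ κ.toFun (dist o x + n * κ.toFun (dist o x)) :=
        κ.mono (mem_Ici.2 dist_nonneg) (mem_Ici.2 (by have := @dist_nonneg _ _ o x; linarith)) h1
    _ ≤ κ.toFun (dist o x) + κ.toFun (n * κ.toFun (dist o x)) :=
        κ.add_le dist_nonneg (by linarith)
    _ ≤ κ.toFun (dist o x) + κ.toFun 1 * (n * κ.toFun (dist o x)) := by
        have := κ.le_one_mul hnk
        linarith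
    _ = (1 + n * κ.toFun 1) * κ.toFun (dist o x) := by ring

end SublinearFunction

section Boundary

variable {X : Type*} [MetricSpace X]

lemma kNbhd_trans (κ : SublinearFunction) {o : X} {A B C : Set X} (hB : B.Nonempty)
    (h₁ : ∃ n, A ⊆ kNbhd κ o B n) (h₂ : ∃ n, B ⊆ kNbhd κ o C n) : ∃ n, A ⊆ kNbhd κ o C n := by
  obtain ⟨n, hn⟩ := h₁
  obtain ⟨k, hk⟩ := h₂
  refine ⟨(|n| + 1) + |k| * (1 + (|n| + 1) * κ 1), fun x hx => ?_⟩
  have hκx := κ.one_le _ (dist_nonneg (x := o) (y := x))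
  have h1 : Metric.infDist x B < (|n| + 1) * κ.toFun (dist o x) := by
    have h := hn hx
    simp only [kNbhd, mem_ofPred_eq] at h
    have := le_abs_self n
    nlinarith
  obtain ⟨y, hy, hxy⟩ := (Metric.infDist_lt_iff hB).1 h1
  have hky := hk hy
  simp only [kNbhd, mem_ofPred_eq] at hky ⊢
  have hc := κ.compare o (by have := abs_nonneg n; linarith : 1 ≤ |n| + 1) hxy.le
  have hκy := κ.pos (dist_nonneg (x := o) (y := y))
  calc Metric.infDist x C ≤ Metric.infDist y C + dist x y := Metric.infDist_le_infDist_add_dist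
    _ ≤ |k| * κ.toFun (dist o y) + (|n| + 1) * κ.toFun (dist o x) := by
        have := mul_le_mul_of_nonneg_right (le_abs_self k) hκy.le
        linarith
    _ ≤ |k| * ((1 + (|n| + 1) * κ.toFun 1) * κ.toFun (dist o x))
          + (|n| + 1) * κ.toFun (dist o x) := by
        have := mul_le_mul_of_nonneg_left hc (abs_nonneg k)
        linarith
    _ = _ := by ring

/-- `κ`-fellow traveling, as an equivalence relation on all quasi-geodesic rays. -/
def fellowTravelSetoid (κ : SublinearFunction) (o : X) : Setoid (QRay o) where
  r := FellowTravel κ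
  iseqv := by
    refine ⟨fun β => ?_, fun h => ⟨h.2, h.1⟩, fun {β γ δ} h h' => ⟨?_, ?_⟩⟩
    · have : range β ⊆ kNbhd κ o (range β) 0 := fun x hx => by
        simp [kNbhd, Metric.infDist_zero_of_mem hx]
      exact ⟨⟨0, this⟩, ⟨0, this⟩⟩
    · exact kNbhd_trans κ (range_nonempty _) h.1 h'.1
    · exact kNbhd_trans κ (range_nonempty _) h'.2 h.2

/-- The set underlying the `κ`-Morse boundary: the `κ`-fellow traveling classes of `κ`-contracting
quasi-geodesic rays. -/
def Boundary (κ : SublinearFunction) (o : X) : Type _ :=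
  {a : Quotient (fellowTravelSetoid κ o) //
    ∃ β : QRay o, IsContracting κ o (range β) ∧ Quotient.mk _ β = a}

/-- The quasi-geodesic rays in the class `a`. -/
def Boundary.rays {κ : SublinearFunction} {o : X} (a : Boundary κ o) : Set (QRay o) :=
  {α | Quotient.mk (fellowTravelSetoid κ o) α = a.1}

/-- The data from which the neighbourhoods in the boundary are made: for each class `b`, the
geodesic ray in `b`, and a strong Morse gauge for it. -/
structure GaugeSystem (κ : SublinearFunction) (o : X) where
  ray : Boundary κ o → QRay o
  ray_mem : ∀ b, ray b ∈ b.rays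
  ray_isometry : ∀ b, Isometry (ray b)
  gauge : Boundary κ o → ℝ → ℝ → ℝ
  gauge_spec : ∀ b, IsStrongMorseGauge κ o (range (ray b)) (gauge b)

namespace GaugeSystem

variable {κ : SublinearFunction} {o : X} (μ : GaugeSystem κ o)

/-- The set `U(b, r)` of all classes `a` such that every `(q, Q)`-quasi-geodesic `α` in `a` for
which `m_b(q, Q)` is small compared to `r` satisfies `α|ᵣ ⊆ N(b, m_b(q, Q))`. -/
def nbhd (b : Boundary κ o) (r : ℝ) : Set (Boundary κ o) :=
  {a | ∀ (q Q : ℝ) (α : QRay o), α ∈ a.rays → IsQIEmbedding q Q α →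
    SmallComparedTo κ (μ.gauge b q Q) r →
    initialPart α r ⊆ kNbhd κ o (range (μ.ray b)) (μ.gauge b q Q)}

end GaugeSystem

lemma exists_le_norm_eq {o : X} (η : QRay o) {r : ℝ} (hr : 0 ≤ r) {t : ℝ≥0}
    (h : r ≤ dist o (η t)) : ∃ s ≤ t, dist o (η s) = r := by
  have hc : ContinuousOn (fun s : ℝ≥0 => dist o (η s)) (Icc 0 t) :=
    (continuous_const.dist η.continuous_toFun).continuousOn
  obtain ⟨s, hs, h'⟩ := intermediate_value_Icc (zero_le : (0 : ℝ≥0) ≤ t) hc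
    (show r ∈ Icc _ _ by simpa [η.start] using ⟨hr, h⟩)
  exact ⟨s, hs.2, h'⟩

lemma exists_norm_eq {o : X} (η : QRay o) {r : ℝ} (hr : 0 ≤ r) :
    {t : ℝ≥0 | dist o (η t) = r}.Nonempty := by
  obtain ⟨q, Q, hq, hQ, h⟩ := η.quasi
  have hq0 : 0 < q := by linarith
  let t : ℝ≥0 := ⟨q * (r + Q), by positivity⟩
  have ht := (h 0 t).1
  have hd : dist (0 : ℝ≥0) t = q * (r + Q) := by
    rw [NNReal.dist_eq]
    simp only [NNReal.coe_zero, zero_sub, abs_neg]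
    exact abs_of_nonneg t.2
  rw [hd, η.start, one_div, inv_mul_cancel_left₀ hq0.ne', add_sub_cancel_right] at ht
  obtain ⟨s, -, hs⟩ := exists_le_norm_eq η hr ht
  exact ⟨s, hs⟩

lemma firstTime_mono {o : X} (η : QRay o) {r r' : ℝ} (hr : 0 ≤ r) (h : r ≤ r') :
    firstTime η r ≤ firstTime η r' := by
  refine le_csInf (exists_norm_eq η (hr.trans h)) fun t ht => ?_
  obtain ⟨s, hst, hs⟩ := exists_le_norm_eq η (t := t) hr (by rw [ht]; exact h)
  exact (csInf_le (OrderBot.bddBelow {t : ℝ≥0 | dist o (η t) = r}) hs).trans hst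

namespace GaugeSystem

variable {κ : SublinearFunction} {o : X} (μ : GaugeSystem κ o)

lemma nbhd_anti (b : Boundary κ o) {r r' : ℝ} (hr : 0 < r) (h : r ≤ r') :
    μ.nbhd b r' ⊆ μ.nbhd b r := fun _ ha q Q α hα hqQ hs =>
  (image_mono (Icc_subset_Icc_right (firstTime_mono α hr.le h))).trans
    (ha q Q α hα hqQ (le_trans hs (κ.div_mono hr h)))

/-- The `κ`-Morse boundary, as a space (with the geodesic rays and gauges of `μ`). -/
def Space (_μ : GaugeSystem κ o) : Type _ := Boundary κ o

/-- The visual topology on quasi-geodesics: `W` is open if for every `b ∈ W` there is `r > 0` with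
`U(b, r) ⊆ W`. -/
instance : TopologicalSpace μ.Space where
  IsOpen W := ∀ b ∈ W, ∃ r : ℝ, 0 < r ∧ μ.nbhd b r ⊆ W
  isOpen_univ := fun _ _ => ⟨1, one_pos, subset_univ _⟩
  isOpen_inter := fun V W hV hW b hb => by
    obtain ⟨r, hr, h⟩ := hV b hb.1
    obtain ⟨r', hr', h'⟩ := hW b hb.2
    exact ⟨max r r', lt_max_of_lt_left hr, subset_inter
      ((μ.nbhd_anti b hr (le_max_left _ _)).trans h)
      ((μ.nbhd_anti b hr' (le_max_right _ _)).trans h')⟩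
  isOpen_sUnion := fun S hS b hb => by
    obtain ⟨V, hV, hbV⟩ := hb
    obtain ⟨r, hr, h⟩ := hS V hV b hbV
    exact ⟨r, hr, h.trans (subset_sUnion_of_mem hV)⟩

end GaugeSystem

end Boundary

end SublinMorse

/-! The two actions make $X_1$ and $X_2$ coarsely equivalent (`exists_coarseEquiv`, Schwarz–Milnor),
so it is enough that a coarse equivalence $\Phi$ with coarse inverse $\Psi$ induces a homeomorphism.
Contraction is not visibly preserved by $\Phi$, but the Morse property is, once it is stated for
quasi-geodesics that need not be continuous (`CoarselyMorse`, `IsCoarseEquiv.coarselyMorse`). The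
two properties are linked in both directions: contracting sets are Morse, because a quasi-geodesic
far from such a set has a slowly moving projection and must soon return
(`ContractingWith.coarselyMorse`); and Morse sets containing the base-point in a CAT(0) space are
contracting, by thin triangles (`IsCAT0.isContracting`). A coarse quasi-geodesic ray with Morse
image is close to a geodesic ray from the base-point (`exists_geodesic_ray`). Hence $\Phi$ and
$\Psi$ induce mutually inverse maps of boundaries.

Strong Morse gauges exist because a long last excursion away from a contracting set has length
sublinear in the radius $R$ it reaches, which is impossible for large $R$
(`IsContracting.exists_strongMorseGauge`).

Continuity (`IsInduced.continuous`) rests on such a gauge in the target: to control a quasi-geodesic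
ray $\alpha'$ up to radius $r'$ it suffices to control one point of it, at a larger radius $R'$.
Smallness bounds the constants of $\alpha'$ by $r'$, so $\Psi\alpha'$ is near a continuous
quasi-geodesic ray with constants depending only on $r'$ and fixed data. Membership in a
neighbourhood of large radius $R$ controls that ray, and $\Phi$ carries the control back to the
point of $\alpha'$. The gauge systems are arbitrary here, so the topology does not depend on them.
-/

namespace SublinMorse

/-! ### Absorption and comparison estimates for sublinear functions -/

namespace SublinearFunction

variable (κ : SublinearFunction)

/-- Sublinearity settles large $t$ and monotonicity the rest. With $\varepsilon = 1/2$, this absorbs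
multiples of $\kappa$ into a norm or radius. -/
lemma exists_mul_le (A : ℝ) {ε : ℝ} (hε : 0 < ε) :
    ∃ B : ℝ, 0 ≤ B ∧ ∀ t, 0 ≤ t → A * κ t ≤ ε * t + B := by
  have hA : 0 < |A| + 1 := by positivity
  have h := (κ.sublinear.eventually (gt_mem_nhds (show (0 : ℝ) < ε / (|A| + 1) by positivity))).and
    (eventually_gt_atTop 0)
  obtain ⟨T, hT⟩ := h.exists_forall_of_atTop
  have hT0 : 0 < T := (hT T le_rfl).2
  refine ⟨|A| * κ T, mul_nonneg (abs_nonneg _) (κ.pos hT0.le).le, fun t ht => ?_⟩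
  have hκt := κ.pos ht
  have h1 : A * κ t ≤ |A| * κ t := mul_le_mul_of_nonneg_right (le_abs_self A) hκt.le
  rcases le_total t T with h | h
  · have h2 := κ.mono (mem_Ici.2 ht) (mem_Ici.2 hT0.le) h
    have h3 := mul_le_mul_of_nonneg_left h2 (abs_nonneg A)
    have : 0 ≤ ε * t := by positivity
    linarith
  · obtain ⟨h2, h3⟩ := hT t h
    rw [div_lt_div_iff₀ h3 hA] at h2
    have h4 : 0 ≤ |A| * κ.toFun T := mul_nonneg (abs_nonneg _) (κ.pos hT0.le).le
    nlinarith

/-- A variant of `compare` where the distance is bounded in terms of the second point. -/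
lemma exists_compare (n : ℝ) : ∃ C : ℝ, 1 ≤ C ∧ ∀ {X : Type*} [MetricSpace X] (o x y : X),
    dist x y ≤ n * κ (dist o y) → κ (dist o y) ≤ C * κ (dist o x) := by
  -- Half of $\|y\|$ absorbs the error $n\kappa(y)$, which leaves $\|y\|\le 2\|x\|+2B$.
  obtain ⟨B, hB, h⟩ := κ.exists_mul_le n (show (0 : ℝ) < 1 / 2 by norm_num)
  have hκB := κ.pos (show 0 ≤ 2 * B by positivity)
  refine ⟨2 + κ (2 * B), by linarith, fun {X} _ o x y hxy => ?_⟩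
  have hx := κ.one_le _ (dist_nonneg (x := o) (y := x))
  have h1 := h _ (dist_nonneg (x := o) (y := y))
  have h2 := dist_triangle o x y
  have h3 : dist o y ≤ 2 * dist o x + 2 * B := by linarith
  have h4 := κ.mono (mem_Ici.2 dist_nonneg) (mem_Ici.2 (dist_nonneg.trans h3)) h3
  have h5 := κ.add_le (show 0 ≤ 2 * dist o x by positivity) (show 0 ≤ 2 * B by positivity)
  have h6 := κ.mul_le (show (1 : ℝ) ≤ 2 by norm_num) (dist_nonneg (x := o) (y := x))
  nlinarith

lemma le_of_dist_le {X : Type*} [MetricSpace X] {o x y : X} {a : ℝ} (ha : 1 ≤ a)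
    (h : dist o y ≤ a * dist o x) : κ (dist o y) ≤ a * κ (dist o x) :=
  (κ.mono (mem_Ici.2 dist_nonneg) (mem_Ici.2 (dist_nonneg.trans h)) h).trans
    (κ.mul_le ha dist_nonneg)

lemma exists_smallComparedTo (D r₀ : ℝ) : ∃ r : ℝ, r₀ ≤ r ∧ 0 < r ∧ SmallComparedTo κ D r := by
  obtain ⟨B, hB, h⟩ := κ.exists_mul_le (2 * D) (show (0 : ℝ) < 1 / 2 by norm_num)
  refine ⟨max (2 * B) (max r₀ 1), (le_max_left _ _).trans (le_max_right _ _),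
    one_pos.trans_le ((le_max_right _ _).trans (le_max_right _ _)), ?_⟩
  set r := max (2 * B) (max r₀ 1)
  have hr : 0 < r := one_pos.trans_le ((le_max_right _ _).trans (le_max_right _ _))
  have h1 := h r hr.le
  have h2 : 2 * B ≤ r := le_max_left _ _
  have hk := κ.pos hr.le
  rw [SmallComparedTo, le_div_iff₀ (by positivity)]
  linarith

/-- Since a gauge dominates $q$ and $Q$, smallness bounds the quasi-geodesic constants by the radius
alone. All uniformity over quasi-geodesics comes from this. -/
lemma le_half_of_small {D r : ℝ} (hr : 0 < r) (h : SmallComparedTo κ D r) : D ≤ r / 2 := by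
  have hk := κ.one_le r hr.le
  refine h.trans ?_
  rw [div_le_div_iff₀ (by linarith) (by norm_num)]
  nlinarith

end SublinearFunction

/-! ### Closeness of sets and coarse quasi-geodesics -/

section Basic

variable {X : Type*} [MetricSpace X] {κ : SublinearFunction} {o : X}

lemma kNbhd_mono {Z : Set X} {m n : ℝ} (h : m ≤ n) : kNbhd κ o Z m ⊆ kNbhd κ o Z n :=
  fun _ hx => le_trans hx (mul_le_mul_of_nonneg_right h (κ.pos dist_nonneg).le)

lemma subset_kNbhd {Z : Set X} {n : ℝ} (hn : 0 ≤ n) : Z ⊆ kNbhd κ o Z n := fun x hx => by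
  simp only [kNbhd, mem_ofPred_eq, Metric.infDist_zero_of_mem hx]
  exact mul_nonneg hn (κ.pos dist_nonneg).le

/-- Closeness of two sets: each is in a `κ`-neighbourhood of the other. -/
def Close (κ : SublinearFunction) (o : X) (A B : Set X) : Prop :=
  (∃ n : ℝ, A ⊆ kNbhd κ o B n) ∧ ∃ n : ℝ, B ⊆ kNbhd κ o A n

lemma Close.symm {A B : Set X} (h : Close κ o A B) : Close κ o B A := ⟨h.2, h.1⟩

lemma Close.trans {A B C : Set X} (hB : B.Nonempty) (h : Close κ o A B) (h' : Close κ o B C) :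
    Close κ o A C := ⟨kNbhd_trans κ hB h.1 h'.1, kNbhd_trans κ hB h'.2 h.2⟩

/-- A set of points at bounded distance from `B` is in a `κ`-neighbourhood of `B`. -/
lemma subset_kNbhd_of_bounded {A B : Set X} {C : ℝ} (h : ∀ x ∈ A, ∃ y ∈ B, dist x y ≤ C) :
    A ⊆ kNbhd κ o B |C| := fun x hx => by
  obtain ⟨y, hy, hxy⟩ := h x hx
  have h1 := κ.one_le _ (dist_nonneg (x := o) (y := x))
  have h2 := Metric.infDist_le_dist_of_mem (x := x) hy
  have h3 := le_abs_self C
  have h4 := abs_nonneg C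
  simp only [kNbhd, mem_ofPred_eq]
  nlinarith

/-- Quasi-isometric embeddings of a set of reals, not necessarily continuous. -/
def QIOn (q Q : ℝ) (f : ℝ → X) (s : Set ℝ) : Prop :=
  1 ≤ q ∧ 0 ≤ Q ∧ ∀ u ∈ s, ∀ v ∈ s, u ≤ v →
    v - u ≤ q * (dist (f u) (f v) + Q) ∧ dist (f u) (f v) ≤ q * (v - u) + Q

lemma QIOn.mono {q Q : ℝ} {f : ℝ → X} {s t : Set ℝ} (h : QIOn q Q f t) (hst : s ⊆ t) :
    QIOn q Q f s := ⟨h.1, h.2.1, fun u hu v hv => h.2.2 u (hst hu) v (hst hv)⟩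

lemma IsQIEmbedding.qiOn {q Q : ℝ} {f : ℝ≥0 → X} (h : IsQIEmbedding q Q f) :
    QIOn q Q (fun t => f t.toNNReal) (Ici 0) := by
  obtain ⟨hq, hQ, h⟩ := h
  refine ⟨hq, hQ, fun u hu v hv huv => ?_⟩
  have h1 := h u.toNNReal v.toNNReal
  have hd : dist u.toNNReal v.toNNReal = v - u := by
    rw [NNReal.dist_eq, Real.coe_toNNReal _ hu, Real.coe_toNNReal _ hv, abs_sub_comm,
      abs_of_nonneg (by linarith)]
  rw [hd] at h1
  refine ⟨?_, h1.2⟩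
  have h2 : 1 / q * (v - u) ≤ dist (f u.toNNReal) (f v.toNNReal) + Q := by linarith [h1.1]
  rwa [one_div, inv_mul_le_iff₀ (by linarith)] at h2

lemma IsQIEmbedding.qiOn_Icc {q Q s t : ℝ} (hst : s ≤ t) {β : Icc s t → X}
    (h : IsQIEmbedding q Q β) : QIOn q Q (fun u => β (projIcc s t hst u)) (Icc s t) := by
  obtain ⟨hq, hQ, h⟩ := h
  refine ⟨hq, hQ, fun u hu v hv huv => ?_⟩
  have h1 := h (projIcc s t hst u) (projIcc s t hst v)
  have hd : dist (projIcc s t hst u) (projIcc s t hst v) = v - u := by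
    rw [projIcc_of_mem _ hu, projIcc_of_mem _ hv, Subtype.dist_eq, Real.dist_eq, abs_sub_comm,
      abs_of_nonneg (by simpa using huv)]
  rw [hd] at h1
  refine ⟨?_, h1.2⟩
  have h2 : 1 / q * (v - u) ≤
      dist (β (projIcc s t hst u)) (β (projIcc s t hst v)) + Q := by linarith [h1.1]
  rwa [one_div, inv_mul_le_iff₀ (by linarith)] at h2

lemma IsQIEmbedding.weaken {Y : Type*} [MetricSpace Y] {q Q q' Q' : ℝ} {f : Y → X}
    (h : IsQIEmbedding q Q f) (hq : q ≤ q') (hQ : Q ≤ Q') : IsQIEmbedding q' Q' f := by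
  obtain ⟨h1, h2, h⟩ := h
  refine ⟨h1.trans hq, h2.trans hQ, fun x y => ⟨?_, ?_⟩⟩
  · have := mul_le_mul_of_nonneg_right (one_div_le_one_div_of_le (by linarith) hq)
      (dist_nonneg (x := x) (y := y))
    linarith [(h x y).1]
  · have := mul_le_mul_of_nonneg_right hq (dist_nonneg (x := x) (y := y))
    linarith [(h x y).2]

/-- The coarse `κ`-Morse property: coarse quasi-geodesic segments whose end points are in a
`κ`-neighbourhood of `Z` stay in a `κ`-neighbourhood of `Z`. -/
def CoarselyMorse (κ : SublinearFunction) (o : X) (Z : Set X) : Prop :=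
  ∀ q Q n : ℝ, ∃ m : ℝ, ∀ (f : ℝ → X) (s t : ℝ), QIOn q Q f (Icc s t) →
    f s ∈ kNbhd κ o Z n → f t ∈ kNbhd κ o Z n → ∀ u ∈ Icc s t, f u ∈ kNbhd κ o Z m

end Basic

/-! ### Contracting sets are Morse and have strong Morse gauges -/

section Contracting

variable {X : Type*} [MetricSpace X] {κ : SublinearFunction} {o : X}

lemma nearest_nonempty [ProperSpace X] {Z : Set X} (hZ : IsClosed Z) (hne : Z.Nonempty) (x : X) :
    (nearest x Z).Nonempty := by
  obtain ⟨z, hz, h⟩ := hZ.exists_infDist_eq_dist hne x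
  exact ⟨z, hz, h.symm⟩

/-- Contraction with an explicit constant. -/
def ContractingWith (κ : SublinearFunction) (o : X) (A : ℝ) (Z : Set X) : Prop :=
  ∀ x y : X, dist x y ≤ Metric.infDist x Z →
    ∀ u ∈ nearest x Z, ∀ v ∈ nearest y Z, dist u v ≤ A * κ (dist o x)

lemma IsContracting.exists_contractingWith {Z : Set X} (h : IsContracting κ o Z) :
    ∃ A : ℝ, 1 ≤ A ∧ ContractingWith κ o A Z := by
  obtain ⟨c, hc⟩ := h
  refine ⟨max c 1, le_max_right _ _, fun x y hxy u hu v hv => ?_⟩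
  exact (hc x y hxy u (Or.inl hu) v (Or.inr hv)).trans
    (mul_le_mul_of_nonneg_right (le_max_left _ _) (κ.pos dist_nonneg).le)

/-- The size of the neighbourhood outside of which quasi-geodesics project efficiently. -/
def excursionConst (A q Q n : ℝ) : ℝ := 4 * q ^ 2 * A + 2 * Q + |n|

section

variable {A q Q n : ℝ}

lemma excursionConst_ge (hA : 1 ≤ A) (hq : 1 ≤ q) (hQ : 0 ≤ Q) :
    4 * q ^ 2 * A ≤ excursionConst A q Q n ∧ 2 * Q ≤ excursionConst A q Q n ∧
      2 * q ≤ excursionConst A q Q n ∧ n ≤ excursionConst A q Q n ∧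
      q ≤ excursionConst A q Q n ∧ Q ≤ excursionConst A q Q n := by
  have h0 := abs_nonneg n
  have h1 := le_abs_self n
  have h2 : q ≤ q ^ 2 := by nlinarith
  have h3 : q ^ 2 ≤ q ^ 2 * A := le_mul_of_one_le_right (by positivity) hA
  unfold excursionConst
  refine ⟨?_, ?_, ?_, ?_, ?_, ?_⟩ <;> linarith

/-- Far from $Z$, the projection of $f$ moves at speed at most $1/(2q)$: in the time $f$ needs to
travel its distance from $Z$, contraction lets the projection move only by a small fraction of that
distance. The two additive terms pay for the last, incomplete step. -/
lemma dist_nearest_le_of_outside {Z : Set X} (hne : ∀ x, (nearest x Z).Nonempty) (hA : 1 ≤ A)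
    (hZ : ContractingWith κ o A Z) {f : ℝ → X} {s' : ℝ} (N : ℕ) : ∀ s : ℝ, s ≤ s' → s' - s ≤ N →
    QIOn q Q f (Icc s s') → (∀ u ∈ Icc s s', f u ∉ kNbhd κ o Z (excursionConst A q Q n)) →
    ∀ u ∈ nearest (f s) Z, ∀ v ∈ nearest (f s') Z,
      dist u v ≤ (s' - s) / (2 * q) + Metric.infDist (f s') Z + Q := by
  induction N with
  | zero =>
    intro s hs hN hf hout u hu v hv
    have hss : s = s' := by
      rw [Nat.cast_zero] at hN
      linarith
    subst hss
    obtain ⟨hq, hQ, -⟩ := hf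
    have h1 := hout s ⟨le_rfl, le_rfl⟩
    simp only [kNbhd, mem_ofPred_eq, not_le] at h1
    have hκ := κ.pos (dist_nonneg (x := o) (y := f s))
    have h2 := hZ (f s) (f s) (by rw [dist_self]; exact Metric.infDist_nonneg) u hu v hv
    have hge := (excursionConst_ge (n := n) hA hq hQ).1
    have h3 : A ≤ excursionConst A q Q n := by
      have : 1 ≤ q ^ 2 := by nlinarith
      nlinarith
    have h4 := mul_le_mul_of_nonneg_right h3 hκ.le
    simp only [sub_self, zero_div]
    linarith
  | succ N ih =>
    intro s hs hN hf hout u hu v hv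
    have hf0 := hf
    obtain ⟨hq, hQ, hqi⟩ := hf
    obtain ⟨g1, g2, g3, -, -, -⟩ := excursionConst_ge (n := n) hA hq hQ
    have h1 := hout s ⟨le_rfl, hs⟩
    simp only [kNbhd, mem_ofPred_eq, not_le] at h1
    set m := excursionConst A q Q n
    set D := Metric.infDist (f s) Z
    set D' := Metric.infDist (f s') Z
    have hκ := κ.one_le _ (dist_nonneg (x := o) (y := f s))
    have hm : m ≤ m * κ.toFun (dist o (f s)) := by nlinarith
    have hq0 : 0 < q := by linarith
    -- the projection moves by at most a small fraction of `D`
    have hAκ : 4 * q ^ 2 * (A * κ.toFun (dist o (f s))) ≤ D := by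
      have := mul_le_mul_of_nonneg_right g1 (show 0 ≤ κ.toFun (dist o (f s)) by linarith)
      linarith
    -- The time in which the upper quasi-isometry bound allows a displacement of at most $D$, so
    -- that contraction applies. It is at least 1, so the induction on the integer bound $N$
    -- advances.
    set δ := (D - Q) / q with hδ
    have hδ' : q * δ + Q = D := by rw [hδ]; field_simp; ring
    have hδ1 : 1 ≤ δ := by
      rw [hδ, le_div_iff₀ hq0]
      linarith
    rcases le_total (s' - s) δ with hle | hle
    · have h2 := (hqi s ⟨le_rfl, hs⟩ s' ⟨hs, le_rfl⟩ hs).2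
      have h3 : q * (s' - s) ≤ q * δ := mul_le_mul_of_nonneg_left hle hq0.le
      have h4 := hZ (f s) (f s') (by linarith) u hu v hv
      have h5 : D ≤ D' + dist (f s) (f s') := Metric.infDist_le_infDist_add_dist
      have h6 : 0 ≤ D' := Metric.infDist_nonneg
      have h7 : dist u v ≤ D / (4 * q ^ 2) := by
        rw [le_div_iff₀ (by positivity)]
        have := mul_le_mul_of_nonneg_left h4 (show 0 ≤ 4 * q ^ 2 by positivity)
        linarith
      have h8 : D / (4 * q ^ 2) ≤ (q * (s' - s) + (Q + D')) / (4 * q ^ 2) := by gcongr; linarith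
      have h9 : (q * (s' - s)) / (4 * q ^ 2) ≤ (s' - s) / (2 * q) := by
        rw [div_le_div_iff₀ (by positivity) (by positivity)]
        have : 0 ≤ (s' - s) * q ^ 2 := mul_nonneg (by linarith) (by positivity)
        nlinarith
      have h10 : (Q + D') / (4 * q ^ 2) ≤ Q + D' := div_le_self (by linarith) (by nlinarith)
      rw [add_div] at h8
      linarith
    · obtain ⟨w, hw⟩ := hne (f (s + δ))
      have hmem : s + δ ∈ Icc s s' := ⟨by linarith, by linarith⟩
      have hsub : Icc (s + δ) s' ⊆ Icc s s' := Icc_subset_Icc_left (by linarith)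
      have h2 := (hqi s ⟨le_rfl, hs⟩ (s + δ) hmem (by linarith)).2
      rw [add_sub_cancel_left] at h2
      have h3 := hZ (f s) (f (s + δ)) (by linarith) u hu w hw
      have h4 := ih (s + δ) hmem.2 (by push_cast at hN; linarith) (hf0.mono hsub)
        (fun u hu => hout u (hsub hu)) w hw v hv
      have h5 : dist u w ≤ δ / (2 * q) := by
        rw [le_div_iff₀ (by positivity)]
        have h6 := mul_le_mul_of_nonneg_left h3 (show 0 ≤ 4 * q ^ 2 by positivity)
        have h7 : q * (2 * (dist u w * (2 * q))) ≤ q * (2 * δ) := by linarith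
        linarith [le_of_mul_le_mul_left h7 hq0]
      have h6 := dist_triangle u w v
      have h7 : (s' - s) / (2 * q) = δ / (2 * q) + (s' - (s + δ)) / (2 * q) := by
        rw [← add_div]; congr 1; ring
      linarith

/-- The length of an excursion outside of a neighbourhood of a contracting set is controlled by
the distances of its end points from the set. -/
lemma excursion_length_le {Z : Set X} (hne : ∀ x, (nearest x Z).Nonempty) (hA : 1 ≤ A)
    (hZ : ContractingWith κ o A Z) {f : ℝ → X} {s s' : ℝ} (hs : s ≤ s')
    (hf : QIOn q Q f (Icc s s'))
    (hout : ∀ u ∈ Icc s s', f u ∉ kNbhd κ o Z (excursionConst A q Q n)) :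
    s' - s ≤ 4 * q * (Metric.infDist (f s) Z + Metric.infDist (f s') Z) := by
  obtain ⟨N, hN⟩ := exists_nat_ge (s' - s)
  obtain ⟨u, hu⟩ := hne (f s)
  obtain ⟨v, hv⟩ := hne (f s')
  have h1 := dist_nearest_le_of_outside hne hA hZ N s hs hN hf hout u hu v hv
  obtain ⟨hq, hQ, hqi⟩ := hf
  obtain ⟨-, g2, -, -, -, -⟩ := excursionConst_ge (n := n) hA hq hQ
  have h2 := (hqi s ⟨le_rfl, hs⟩ s' ⟨hs, le_rfl⟩ hs).1
  have h3 := hout s ⟨le_rfl, hs⟩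
  simp only [kNbhd, mem_ofPred_eq, not_le] at h3
  have hκ := κ.one_le _ (dist_nonneg (x := o) (y := f s))
  have h4 : 2 * Q ≤ Metric.infDist (f s) Z := by nlinarith
  have h5 : dist (f s) (f s') ≤ Metric.infDist (f s) Z + dist u v + Metric.infDist (f s') Z := by
    rw [← hu.2, ← hv.2, dist_comm (f s') v]
    exact dist_triangle4 _ _ _ _
  have hq0 : 0 < q := by linarith
  have h6 := mul_le_mul_of_nonneg_left h5 hq0.le
  have h7 := mul_le_mul_of_nonneg_left h1 hq0.le
  -- The projection accounts for only half of the length, which is absorbed on the left.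
  have h8 : q * ((s' - s) / (2 * q)) = (s' - s) / 2 := by field_simp
  have h9 := mul_le_mul_of_nonneg_left h4 hq0.le
  have h10 : 0 ≤ q * Metric.infDist (f s') Z := mul_nonneg hq0.le Metric.infDist_nonneg
  nlinarith

/-- Without continuity of the path the last visit need not exist, so a visit within 1 of the
supremum is taken. The lost unit of time costs at most $q+Q$ in distance. -/
lemma exists_last_visit {P : ℝ → Prop} {s u : ℝ} (hsu : s ≤ u) (hs : P s) :
    ∃ a ∈ Icc s u, P a ∧ ∀ v ∈ Icc (a + 1) u, ¬ P v := by
  have hbdd : BddAbove {a | a ∈ Icc s u ∧ P a} := ⟨u, fun a ha => ha.1.2⟩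
  obtain ⟨a, ha, h⟩ := exists_lt_of_lt_csSup (s := {a | a ∈ Icc s u ∧ P a})
    ⟨s, ⟨le_rfl, hsu⟩, hs⟩ (sub_one_lt (sSup {a | a ∈ Icc s u ∧ P a}))
  refine ⟨a, ha.1, ha.2, fun v hv hPv => ?_⟩
  have := le_csSup hbdd (show v ∈ {a | a ∈ Icc s u ∧ P a} from
    ⟨⟨by linarith [ha.1.1, hv.1], hv.2⟩, hPv⟩)
  linarith [hv.1]

lemma exists_next_visit {P : ℝ → Prop} {u t : ℝ} (hut : u ≤ t) (ht : P t) :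
    ∃ a ∈ Icc u t, P a ∧ ∀ v ∈ Icc u (a - 1), ¬ P v := by
  obtain ⟨a, ha, hPa, h⟩ := exists_last_visit (P := fun x => P (-x)) (neg_le_neg hut)
    (show P (- -t) by rwa [neg_neg])
  refine ⟨-a, ⟨by linarith [ha.2], by linarith [ha.1]⟩, hPa, fun v hv hPv => ?_⟩
  exact h (-v) ⟨by linarith [hv.2], by linarith [hv.1]⟩ (by rwa [neg_neg])

lemma infDist_le_of_visit {Z : Set X} {f : ℝ → X} {a b : ℝ} {m : ℝ} (hq : 1 ≤ q) (hQ : 0 ≤ Q)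
    (ha : f a ∈ kNbhd κ o Z m) (hd : dist (f a) (f b) ≤ q + Q) :
    Metric.infDist (f b) Z ≤ (m + q + Q) * κ (dist o (f a)) := by
  simp only [kNbhd, mem_ofPred_eq] at ha
  have h1 : Metric.infDist (f b) Z ≤ Metric.infDist (f a) Z + dist (f b) (f a) :=
    Metric.infDist_le_infDist_add_dist
  rw [dist_comm] at h1
  have hκ := κ.one_le _ (dist_nonneg (x := o) (y := f a))
  nlinarith

/-- The coarse Morse property of contracting sets. -/
theorem ContractingWith.coarselyMorse {Z : Set X} (hne : ∀ x, (nearest x Z).Nonempty) (hA : 1 ≤ A)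
    (hZ : ContractingWith κ o A Z) (q Q n : ℝ) :
    ∃ m : ℝ, excursionConst A q Q n ≤ m ∧ ∀ (f : ℝ → X) (s t : ℝ), QIOn q Q f (Icc s t) →
      f s ∈ kNbhd κ o Z (excursionConst A q Q n) → f t ∈ kNbhd κ o Z (excursionConst A q Q n) →
      ∀ u ∈ Icc s t, f u ∈ kNbhd κ o Z m := by
  set m₀ := excursionConst A q Q n with hm₀
  set M := m₀ + q + Q with hM
  set B := q * (2 + 8 * q * M) + Q with hB
  obtain ⟨C, hC, hcomp⟩ := κ.exists_compare B
  refine ⟨max m₀ ((B + m₀) * C), le_max_left _ _, fun f s t hf hs ht u hu => ?_⟩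
  by_cases hfu : f u ∈ kNbhd κ o Z m₀
  · exact kNbhd_mono (le_max_left _ _) hfu
  obtain ⟨a, ha, hPa, hout⟩ := exists_last_visit (P := fun v => f v ∈ kNbhd κ o Z m₀) hu.1 hs
  obtain ⟨b, hb, hPb, hout'⟩ := exists_next_visit (P := fun v => f v ∈ kNbhd κ o Z m₀) hu.2 ht
  have hf0 := hf
  obtain ⟨hq, hQ, hqi⟩ := hf
  obtain ⟨g1, g2, g3, -, g5, -⟩ := excursionConst_ge (n := n) hA hq hQ
  rw [← hm₀] at g1 g2 g3 g5
  have hma : a ∈ Icc s t := ⟨ha.1, ha.2.trans hu.2⟩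
  have hmb : b ∈ Icc s t := ⟨hu.1.trans hb.1, hb.2⟩
  have hab : a ≤ b := ha.2.trans hb.1
  have hM0 : 0 ≤ M := by linarith
  have hκa := κ.one_le _ (dist_nonneg (x := o) (y := f a))
  have hκb := κ.one_le _ (dist_nonneg (x := o) (y := f b))
  have hqM : 0 ≤ q * M := by positivity
  -- the length of the excursion
  have hlen : b - a ≤ 2 + 4 * q * M * (κ.toFun (dist o (f a)) + κ.toFun (dist o (f b))) := by
    -- A unit of time is cut off at each end of the excursion, so short ones are treated apart.
    by_cases h2 : b - a ≤ 2
    · have : 0 ≤ q * M * (κ.toFun (dist o (f a)) + κ.toFun (dist o (f b))) :=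
        mul_nonneg hqM (by linarith)
      linarith
    push Not at h2
    have h3 : a + 1 ≤ b - 1 := by linarith
    have hsub : Icc (a + 1) (b - 1) ⊆ Icc s t :=
      Icc_subset_Icc (by linarith [hma.1]) (by linarith [hmb.2])
    have h4 := excursion_length_le (n := n) hne hA hZ h3 (hf0.mono hsub) (fun v hv => by
      rcases le_total v u with h | h
      · exact hout v ⟨hv.1, h⟩
      · exact hout' v ⟨h, hv.2⟩)
    have h5 := infDist_le_of_visit (b := a + 1) hq hQ hPa (by
      have := (hqi a hma (a + 1) (hsub ⟨le_rfl, h3⟩) (by linarith)).2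
      rwa [add_sub_cancel_left, mul_one] at this)
    have h6 := infDist_le_of_visit (b := b - 1) hq hQ hPb (by
      have := (hqi (b - 1) (hsub ⟨h3, le_rfl⟩) b hmb (by linarith)).2
      rwa [sub_sub_cancel, mul_one, dist_comm] at this)
    have h7 := mul_le_mul_of_nonneg_left (add_le_add h5 h6) (show 0 ≤ 4 * q by linarith)
    rw [← hM] at h7
    linarith
  -- Here $w$ is whichever end of the excursion has the larger value of $\kappa$. That value bounds
  -- the whole excursion, and `exists_compare` converts it into a multiple of $\kappa$ at $f(u)$.
  have key : ∀ w ∈ Icc s t, f w ∈ kNbhd κ o Z m₀ → κ.toFun (dist o (f a)) ≤ κ.toFun (dist o (f w)) →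
      κ.toFun (dist o (f b)) ≤ κ.toFun (dist o (f w)) → dist (f u) (f w) ≤ q * (b - a) + Q →
      f u ∈ kNbhd κ o Z (max m₀ ((B + m₀) * C)) := by
    intro w hw hPw h1 h2 h3
    refine kNbhd_mono (le_max_right _ _) ?_
    have hκw := κ.one_le _ (dist_nonneg (x := o) (y := f w))
    have h4 : dist (f u) (f w) ≤ B * κ.toFun (dist o (f w)) := by
      have h5 : b - a ≤ (2 + 8 * q * M) * κ.toFun (dist o (f w)) := by nlinarith
      have h6 := mul_le_mul_of_nonneg_left h5 (show 0 ≤ q by linarith)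
      have h7 : Q ≤ Q * κ.toFun (dist o (f w)) := le_mul_of_one_le_right hQ hκw
      rw [hB]
      linarith
    have h5 := hcomp o _ _ h4
    have h6 : Metric.infDist (f u) Z ≤ Metric.infDist (f w) Z + dist (f u) (f w) :=
      Metric.infDist_le_infDist_add_dist
    simp only [kNbhd, mem_ofPred_eq] at hPw ⊢
    have h7 : 0 ≤ B + m₀ := by
      have : 0 ≤ q * (2 + 8 * q * M) := by nlinarith
      linarith
    have h8 := mul_le_mul_of_nonneg_left h5 h7
    linarith
  rcases le_total (κ.toFun (dist o (f a))) (κ.toFun (dist o (f b))) with h | h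
  · refine key b hmb hPb h le_rfl ((hqi u hu b hmb hb.1).2.trans ?_)
    have := mul_le_mul_of_nonneg_left (sub_le_sub_left ha.2 b) (show 0 ≤ q by linarith)
    linarith
  · refine key a hma hPa le_rfl h ?_
    rw [dist_comm]
    refine (hqi a hma u hu ha.2).2.trans ?_
    have := mul_le_mul_of_nonneg_left (sub_le_sub_right hb.1 a) (show 0 ≤ q by linarith)
    linarith

end

lemma IsContracting.coarselyMorse {Z : Set X} (hne : ∀ x, (nearest x Z).Nonempty)
    (hZ : IsContracting κ o Z) : CoarselyMorse κ o Z := by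
  obtain ⟨A, hA, h⟩ := hZ.exists_contractingWith
  intro q Q n
  obtain ⟨m, -, hm⟩ := h.coarselyMorse hne hA q Q n
  refine ⟨m, fun f s t hf hs ht u hu => ?_⟩
  have hn := (excursionConst_ge (n := n) hA hf.1 hf.2.1).2.2.2.1
  exact hm f s t hf (kNbhd_mono hn hs) (kNbhd_mono hn ht) u hu

/-! ### Quasi-geodesic rays up to a given radius -/

lemma dist_firstTime (η : QRay o) {r : ℝ} (hr : 0 ≤ r) : dist o (η (firstTime η r)) = r := by
  have hcl : IsClosed {t : ℝ≥0 | dist o (η t) = r} :=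
    isClosed_eq (continuous_const.dist η.continuous_toFun) continuous_const
  exact hcl.csInf_mem (exists_norm_eq η hr) (OrderBot.bddBelow _)

lemma firstTime_le (η : QRay o) {r : ℝ} {t : ℝ≥0} (h : dist o (η t) = r) : firstTime η r ≤ t :=
  csInf_le (OrderBot.bddBelow {t : ℝ≥0 | dist o (η t) = r}) h

lemma norm_le_of_le_firstTime (η : QRay o) {r : ℝ} (hr : 0 ≤ r) {t : ℝ≥0}
    (ht : t ≤ firstTime η r) : dist o (η t) ≤ r := by
  by_contra! h
  obtain ⟨s, hst, hs⟩ := exists_le_norm_eq η hr h.le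
  have := firstTime_le η hs
  rw [← le_antisymm hst (ht.trans this), hs] at h
  exact lt_irrefl _ h

lemma le_firstTime (η : QRay o) {r : ℝ} (hr : 0 ≤ r) {t : ℝ≥0}
    (h : ∀ u ≤ t, dist o (η u) < r) : t ≤ firstTime η r := by
  by_contra! hlt
  have := h _ hlt.le
  rw [dist_firstTime η hr] at this
  exact lt_irrefl _ this

lemma exists_radius (κ' : SublinearFunction) (K₁ K₂ r : ℝ) :
    ∃ R : ℝ, 0 < R ∧ r ≤ R ∧ K₁ + K₂ * κ' R < R := by
  obtain ⟨B, hB, h⟩ := κ'.exists_mul_le K₂ (show (0 : ℝ) < 1 / 2 by norm_num)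
  refine ⟨|r| + 2 * |K₁| + 2 * B + 1, by positivity, ?_, ?_⟩
  · linarith [le_abs_self r, abs_nonneg K₁]
  · have h1 := h (|r| + 2 * |K₁| + 2 * B + 1) (by positivity)
    linarith [le_abs_self K₁, abs_nonneg r]

/-- Closed contracting sets that contain the base-point have strong Morse gauges. -/
theorem IsContracting.exists_strongMorseGauge {Z : Set X} (hne : ∀ x, (nearest x Z).Nonempty)
    (ho : o ∈ Z) (hZ : IsContracting κ o Z) : ∃ m, IsStrongMorseGauge κ o Z m := by
  obtain ⟨A, hA, hZ⟩ := hZ.exists_contractingWith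
  choose m₁ hm₁ hm using fun q Q => hZ.coarselyMorse hne hA q Q 0
  set e : ℝ → ℝ → ℝ := fun q Q => excursionConst A q Q 0 with he
  -- The added $q+Q$ makes the gauge also bound the distance from $Z$, relative to $\kappa$ at the
  -- visit, one unit of time after a visit.
  set m : ℝ → ℝ → ℝ := fun q Q => m₁ q Q + q + Q with hmdef
  have hle : ∀ q Q, 1 ≤ q → 0 ≤ Q → m₁ q Q ≤ m q Q ∧ max q Q ≤ m q Q ∧
      e q Q + q + Q ≤ m q Q := fun q Q hq hQ => by
    have g := excursionConst_ge (n := 0) hA hq hQ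
    have h1 := hm₁ q Q
    exact ⟨by simp only [hmdef]; linarith, max_le (by simp only [hmdef]; linarith)
      (by simp only [hmdef]; linarith), by simp only [hmdef, he]; linarith⟩
  refine ⟨m, ⟨fun q Q hq hQ => (hle q Q hq hQ).2.1, ?_⟩, ?_⟩
  · rintro q Q s t hst β - hβ h1 h2 _ ⟨u, rfl⟩
    have hg := (excursionConst_ge (n := 0) hA hβ.1 hβ.2.1).2.2.2.1
    have h3 := hm q Q _ s t (hβ.qiOn_Icc hst)
      (subset_kNbhd hg (by rwa [projIcc_left])) (subset_kNbhd hg (by rwa [projIcc_right])) u u.2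
    rw [projIcc_val] at h3
    exact kNbhd_mono (hle q Q hβ.1 hβ.2.1).1 h3
  · intro r n hr hn κ'
    -- The choice uses only $r$, $n$, $\kappa'$: the constants bound $r\,t_R + r$ from above if
    -- $\eta$ does not return to $Z$ between time $u$ and $t_R$, with $q$, $Q$ and the gauge
    -- replaced by $r$. But $R \le r\,t_R + r$.
    obtain ⟨R, hR0, hrR, hR⟩ :=
      exists_radius κ' (r + r * (2 * r ^ 2 + 1 + 4 * r ^ 2 * κ r)) (4 * r ^ 2 * n) r
    refine ⟨R, hR0, fun q Q η hη hsmall hclose => ?_⟩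
    have hf := hη.qiOn
    set f : ℝ → X := fun t => η t.toNNReal with hfdef
    obtain ⟨hq, hQ, hqi⟩ := hf
    obtain ⟨hle1, hle2, hle3⟩ := hle q Q hq hQ
    obtain ⟨-, -, -, g0, g5, g6⟩ := excursionConst_ge (n := 0) hA hq hQ
    rintro _ ⟨u, hu, rfl⟩
    have hfη : ∀ t : ℝ≥0, f t = η t := fun t => by simp [hfdef]
    rw [← hfη u]
    set tR : ℝ≥0 := firstTime η R
    have htrR : firstTime η r ≤ tR := firstTime_mono η hr.le hrR
    have huR : (u : ℝ) ≤ tR := by exact_mod_cast hu.2.trans htrR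
    have hf0 : f 0 ∈ kNbhd κ o Z (e q Q) := subset_kNbhd g0 (by
      simp only [hfdef, Real.toNNReal_zero, η.start]; exact ho)
    -- If $\eta$ returns near $Z$ by time $t_R$, the Morse property on $[0,b]$ suffices. Otherwise
    -- its last excursion lasts until $t_R$ and is too short to reach radius $R$.
    by_cases hret : ∃ b ∈ Icc (u : ℝ) tR, f b ∈ kNbhd κ o Z (e q Q)
    · obtain ⟨b, hb, hfb⟩ := hret
      exact kNbhd_mono hle1 (hm q Q f 0 b ((hη.qiOn).mono fun x hx => hx.1) hf0 hfb u
        ⟨u.2, hb.1⟩)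
    push Not at hret
    obtain ⟨a, ha, hPa, hout⟩ :=
      exists_last_visit (P := fun v => f v ∈ kNbhd κ o Z (e q Q)) u.2 hf0
    have hκa := κ.one_le _ (dist_nonneg (x := o) (y := f a))
    exfalso
    -- all constants are at most `r`
    have hmr : m q Q ≤ r := by linarith [κ.le_half_of_small hr hsmall]
    have hqr : q ≤ r := (le_max_left _ _).trans (hle2.trans hmr)
    have hQr : Q ≤ r := (le_max_right _ _).trans (hle2.trans hmr)
    have hna : dist o (f a) ≤ r := norm_le_of_le_firstTime η hr.le
      ((Real.toNNReal_le_iff_le_coe.2 ha.2).trans hu.2)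
    have hκar : κ.toFun (dist o (f a)) ≤ κ r := κ.mono (mem_Ici.2 dist_nonneg) (mem_Ici.2 hr.le) hna
    have hκr := κ.one_le r hr.le
    have hκ'R := κ'.one_le R hR0.le
    have hfo : f 0 = o := by simp only [hfdef, Real.toNNReal_zero, η.start]
    have haq : a ≤ 2 * r ^ 2 := by
      have h1 := (hqi 0 (mem_Ici.2 le_rfl) a (mem_Ici.2 ha.1) ha.1).1
      rw [hfo, sub_zero] at h1
      have h2 : q * (dist o (f a) + Q) ≤ r * (r + r) :=
        mul_le_mul hqr (by linarith) (by positivity) hr.le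
      nlinarith
    have htR : R ≤ r * tR + r := by
      have h1 := (hqi 0 (mem_Ici.2 le_rfl) tR (mem_Ici.2 tR.2) tR.2).2
      rw [hfo, hfη, dist_firstTime η hR0.le, sub_zero] at h1
      have h2 : q * (tR : ℝ) ≤ r * tR := mul_le_mul_of_nonneg_right hqr tR.2
      linarith
    have hlast : (tR : ℝ) ≤ 2 * r ^ 2 + 1 + 4 * r ^ 2 * κ r + 4 * r * (n * κ' R) := by
      have hnn : 0 ≤ r ^ 2 * κ r + r * (n * κ' R) := by positivity
      by_cases h1 : (tR : ℝ) ≤ a + 1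
      · linarith
      push Not at h1
      have hsub : Icc (a + 1) (tR : ℝ) ⊆ Ici 0 := fun x hx => by
        have := hx.1
        have := ha.1
        exact mem_Ici.2 (by linarith)
      have h2 := excursion_length_le (n := 0) hne hA hZ h1.le ((hη.qiOn).mono hsub)
        (fun v hv => by
          rcases le_total v u with h | h
          · exact hout v ⟨hv.1, h⟩
          · exact hret v ⟨h, hv.2⟩)
      have h3 := infDist_le_of_visit (b := a + 1) hq hQ hPa (by
        have := (hqi a (mem_Ici.2 ha.1) (a + 1) (hsub ⟨le_rfl, h1.le⟩) (by linarith)).2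
        rwa [add_sub_cancel_left, mul_one] at this)
      have h4 : (e q Q + q + Q) * κ.toFun (dist o (f a)) ≤ r * κ r :=
        mul_le_mul (hle3.trans hmr) hκar (by linarith) hr.le
      have h5 : Metric.infDist (η (tR : ℝ).toNNReal) Z ≤ n * κ'.toFun R := by
        rwa [Real.toNNReal_coe]
      have h6 : 4 * q * (Metric.infDist (η (a + 1).toNNReal) Z +
          Metric.infDist (η (tR : ℝ).toNNReal) Z) ≤ 4 * r * (r * κ r + n * κ' R) := by
        refine mul_le_mul (by linarith) ?_ (add_nonneg Metric.infDist_nonneg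
          Metric.infDist_nonneg) (by linarith)
        exact add_le_add (h3.trans h4) h5
      nlinarith
    have := mul_le_mul_of_nonneg_left hlast hr.le
    nlinarith

end Contracting

/-! ### Geodesics and homotheties in CAT(0) spaces -/

section Geodesics

variable {X : Type*} [MetricSpace X]

namespace IsGeodesicSegment

variable {γ : ℝ → X} {ℓ : ℝ} {x y : X}

lemma dist_eq (h : IsGeodesicSegment γ ℓ x y) : dist x y = ℓ := by
  have := h.isom 0 ⟨le_rfl, h.nonneg⟩ ℓ ⟨h.nonneg, le_rfl⟩
  rwa [h.left, h.right, zero_sub, abs_neg, abs_of_nonneg h.nonneg] at this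

lemma dist_of_le (h : IsGeodesicSegment γ ℓ x y) {s t : ℝ} (hs : 0 ≤ s) (hst : s ≤ t)
    (ht : t ≤ ℓ) : dist (γ s) (γ t) = t - s := by
  rw [h.isom s ⟨hs, hst.trans ht⟩ t ⟨hs.trans hst, ht⟩, abs_sub_comm, abs_of_nonneg (by linarith)]

lemma reverse (h : IsGeodesicSegment γ ℓ x y) : IsGeodesicSegment (fun t => γ (ℓ - t)) ℓ y x where
  nonneg := h.nonneg
  left := by simp [h.right]
  right := by simp [h.left]
  isom s hs t ht := by
    rw [h.isom _ ⟨by linarith [hs.2], by linarith [hs.1]⟩ _ ⟨by linarith [ht.2], by linarith [ht.1]⟩,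
      sub_sub_sub_cancel_left, abs_sub_comm]

lemma initial (h : IsGeodesicSegment γ ℓ x y) {t : ℝ} (ht : t ∈ Icc 0 ℓ) :
    IsGeodesicSegment γ t x (γ t) where
  nonneg := ht.1
  left := h.left
  right := rfl
  isom s hs u hu := h.isom s ⟨hs.1, hs.2.trans ht.2⟩ u ⟨hu.1, hu.2.trans ht.2⟩

lemma continuousOn (h : IsGeodesicSegment γ ℓ x y) : ContinuousOn γ (Icc 0 ℓ) :=
  (LipschitzOnWith.of_dist_le_mul (K := 1) fun s hs t ht => by
    rw [h.isom s hs t ht, Real.dist_eq, NNReal.coe_one, one_mul]).continuousOn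

end IsGeodesicSegment

lemma exists_comparison_triangle {a b c : ℝ} (ha : 0 ≤ a) (hb : 0 ≤ b) (hc : 0 ≤ c)
    (h₁ : c ≤ a + b) (h₂ : a ≤ b + c) (h₃ : b ≤ a + c) :
    ∃ p q r : EuclideanSpace ℝ (Fin 2), dist p q = a ∧ dist p r = b ∧ dist q r = c := by
  rcases ha.eq_or_lt with rfl | ha
  · have hbc : b = c := by linarith
    subst hbc
    refine ⟨0, 0, !₂[b, 0], by simp, ?_, ?_⟩ <;>
    · rw [EuclideanSpace.dist_eq, Fin.sum_univ_two]
      simp [Real.sqrt_sq hb]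
  -- First coordinate of the third vertex, from the law of cosines.
  set x : ℝ := (a ^ 2 + b ^ 2 - c ^ 2) / (2 * a) with hx
  have hxa : 2 * a * x = a ^ 2 + b ^ 2 - c ^ 2 := by rw [hx]; field_simp
  have hxb : 0 ≤ b ^ 2 - x ^ 2 := by
    have h4 : 0 ≤ 2 * a * (b - x) := by
      have : 2 * a * (b - x) = (c - (a - b)) * (c + (a - b)) := by
        rw [mul_sub, hxa]; ring
      rw [this]
      exact mul_nonneg (by linarith) (by linarith)
    have h5 : 0 ≤ 2 * a * (b + x) := by
      have : 2 * a * (b + x) = (a + b - c) * (a + b + c) := by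
        rw [mul_add, hxa]; ring
      rw [this]
      exact mul_nonneg (by linarith) (by linarith)
    have h6 : 0 ≤ b - x := nonneg_of_mul_nonneg_right h4 (by linarith)
    have h7 : 0 ≤ b + x := nonneg_of_mul_nonneg_right h5 (by linarith)
    nlinarith
  have hy := Real.sq_sqrt hxb
  refine ⟨0, !₂[a, 0], !₂[x, √(b ^ 2 - x ^ 2)], ?_, ?_, ?_⟩ <;>
    rw [EuclideanSpace.dist_eq, Fin.sum_univ_two] <;>
    simp only [Real.dist_eq, sq_abs, PiLp.zero_apply, Matrix.cons_val_zero,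
      Matrix.cons_val_one, zero_sub, neg_sq, Matrix.cons_val_fin_one]
  · rw [zero_pow two_ne_zero, add_zero, Real.sqrt_sq ha.le]
  · rw [hy, add_sub_cancel, Real.sqrt_sq hb]
  · rw [hy, show (a - x) ^ 2 + (b ^ 2 - x ^ 2) = c ^ 2 by linarith, Real.sqrt_sq hc]

/-- Contracting a CAT(0) space along geodesics from a point by the factor `c` contracts distances
by the factor `c`. -/
lemma IsCAT0.dist_homothety_le (hX : IsCAT0 X) {p q r : X} {γ δ : ℝ → X} {a b : ℝ}
    (hγ : IsGeodesicSegment γ a p q) (hδ : IsGeodesicSegment δ b p r) {c : ℝ} (hc : c ∈ Icc 0 1) :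
    dist (γ (c * a)) (δ (c * b)) ≤ c * dist q r := by
  obtain ⟨p', q', r', h₁, h₂, h₃⟩ := exists_comparison_triangle (dist_nonneg (x := p) (y := q))
    (dist_nonneg (x := p) (y := r)) (dist_nonneg (x := q) (y := r))
    (by rw [dist_comm p q]; exact dist_triangle _ _ _)
    (by rw [dist_comm q r]; exact dist_triangle _ _ _) (dist_triangle _ _ _)
  have ha : c * a ∈ Icc 0 a := ⟨mul_nonneg hc.1 hγ.nonneg, mul_le_of_le_one_left hγ.nonneg hc.2⟩
  have hb : c * b ∈ Icc 0 b := ⟨mul_nonneg hc.1 hδ.nonneg, mul_le_of_le_one_left hδ.nonneg hc.2⟩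
  have hdist : ∀ z w : EuclideanSpace ℝ (Fin 2), dist z (AffineMap.lineMap z w c) = c * dist z w :=
    fun z w => by rw [dist_left_lineMap, Real.norm_of_nonneg hc.1]
  refine (hX.thin p q r γ δ a b hγ hδ p' q' r' h₁ h₂ h₃ (c * a) ha (c * b) hb
    (AffineMap.lineMap p' q' c) ?_ (AffineMap.lineMap p' r' c) ?_ ?_ ?_).trans ?_
  · rw [segment_eq_image_lineMap]; exact mem_image_of_mem _ hc
  · rw [segment_eq_image_lineMap]; exact mem_image_of_mem _ hc
  · rw [hdist, h₁, ((hγ.initial ha).dist_eq), hγ.dist_eq]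
  · rw [hdist, h₂, ((hδ.initial hb).dist_eq), hδ.dist_eq]
  · rw [← h₃, dist_eq_norm, dist_eq_norm, AffineMap.lineMap_apply_module,
      AffineMap.lineMap_apply_module]
    have : (1 - c) • p' + c • q' - ((1 - c) • p' + c • r') = c • (q' - r') := by
      rw [smul_sub]; abel
    rw [this, norm_smul, Real.norm_of_nonneg hc.1]

/-- Points on a geodesic from `p` to `x` have `p` as a nearest point if `x` does. -/
lemma IsGeodesicSegment.infDist_eq {Z : Set X} {p x : X} {γ : ℝ → X} {ℓ : ℝ}
    (hγ : IsGeodesicSegment γ ℓ p x) (hp : p ∈ nearest x Z) {s : ℝ} (hs : s ∈ Icc 0 ℓ) :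
    Metric.infDist (γ s) Z = s := by
  have h1 : dist (γ s) p = s := by rw [dist_comm]; exact (hγ.initial hs).dist_eq
  refine le_antisymm ?_ ?_
  · exact (Metric.infDist_le_dist_of_mem hp.1).trans h1.le
  · have h2 : Metric.infDist x Z ≤ Metric.infDist (γ s) Z + dist x (γ s) :=
      Metric.infDist_le_infDist_add_dist
    have h3 := hγ.dist_of_le hs.1 hs.2 le_rfl
    rw [hγ.right, dist_comm] at h3
    rw [← hp.2, dist_comm, hγ.dist_eq] at h2
    linarith

lemma IsGeodesicSegment.mem_nearest {Z : Set X} {p x : X} {γ : ℝ → X} {ℓ : ℝ}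
    (hγ : IsGeodesicSegment γ ℓ p x) (hp : p ∈ nearest x Z) {s : ℝ} (hs : s ∈ Icc 0 ℓ) :
    p ∈ nearest (γ s) Z :=
  ⟨hp.1, by rw [hγ.infDist_eq hp hs, dist_comm]; exact (hγ.initial hs).dist_eq⟩

/-- In a triangle, the distance from the side `σ` decreases on the way to the vertex `x` of `σ`. -/
lemma IsCAT0.infDist_anti (hX : IsCAT0 X) {p x y : X} {γ σ : ℝ → X} {ℓ L : ℝ}
    (hγ : IsGeodesicSegment γ ℓ p x) (hσ : IsGeodesicSegment σ L x y) {r s : ℝ} (hr : 0 ≤ r)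
    (hrs : r ≤ s) (hs : s ≤ ℓ) :
    Metric.infDist (γ s) (σ '' Icc 0 L) ≤ Metric.infDist (γ r) (σ '' Icc 0 L) := by
  rcases hrs.eq_or_lt with rfl | hlt
  · exact le_rfl
  obtain ⟨_, ⟨θ, hθ, rfl⟩, hd⟩ := (isCompact_Icc.image_of_continuousOn
    hσ.continuousOn).exists_infDist_eq_dist ⟨σ 0, mem_image_of_mem _ ⟨le_rfl, hσ.nonneg⟩⟩ (γ r)
  have hpos : 0 < ℓ - r := by linarith
  -- The homothety centred at $x$ with this factor takes $\gamma(r)$ to $\gamma(s)$ and keeps points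
  -- of $\sigma$ on $\sigma$.
  set c := (ℓ - s) / (ℓ - r) with hc
  have hc01 : c ∈ Icc (0 : ℝ) 1 :=
    ⟨div_nonneg (by linarith) hpos.le, (div_le_one hpos).2 (by linarith)⟩
  have h := hX.dist_homothety_le (hγ.reverse.initial ⟨hpos.le, by linarith⟩) (hσ.initial hθ) hc01
  have h1 : ℓ - c * (ℓ - r) = s := by rw [hc, div_mul_cancel₀ _ hpos.ne']; ring
  simp only [h1, sub_sub_cancel] at h
  have hmem : c * θ ∈ Icc 0 L :=
    ⟨mul_nonneg hc01.1 hθ.1, (mul_le_of_le_one_left hθ.1 hc01.2).trans hθ.2⟩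
  calc Metric.infDist (γ s) (σ '' Icc 0 L) ≤ dist (γ s) (σ (c * θ)) :=
        Metric.infDist_le_dist_of_mem (mem_image_of_mem _ hmem)
    _ ≤ c * dist (γ r) (σ θ) := h
    _ ≤ dist (γ r) (σ θ) := mul_le_of_le_one_left dist_nonneg hc01.2
    _ = _ := hd.symm

end Geodesics

/-! ### Morse sets in CAT(0) spaces are contracting -/

section MorseContracting

variable {X : Type*} [MetricSpace X] {κ : SublinearFunction} {o : X}

/-- Going up from `p`, crossing to the side `σ`, and following `σ`, is a quasi-geodesic. -/
lemma qiOn_detour {p x y a v : X} {γ σ ζ : ℝ → X} {ℓ L s e τ : ℝ}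
    (hγ : IsGeodesicSegment γ ℓ p x) (hσ : IsGeodesicSegment σ L x y)
    (hζ : IsGeodesicSegment ζ e a v) (hs : s ∈ Icc 0 ℓ) (hτ : τ ∈ Icc 0 L) (ha : γ s = a)
    (hv : σ τ = v) (hse : s ≤ e)
    (hfar : ∀ r ∈ Icc 0 s, ∀ θ ∈ Icc 0 L, e ≤ dist (γ r) (σ θ)) :
    QIOn 5 0 (fun r => if r ≤ s then γ r else if r ≤ s + e then ζ (r - s) else σ (τ + (r - s - e)))
      (Icc 0 (s + e + (L - τ))) := by
  subst ha hv
  -- the distances between points on different pieces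
  have h12 : ∀ r ∈ Icc 0 s, ∀ t ∈ Icc 0 e, (s - r) + t ≤ 3 * dist (γ r) (ζ t) ∧
      dist (γ r) (ζ t) ≤ (s - r) + t := fun r hr t ht => by
    -- The distance is at least $t$, because $\gamma(r)$ is at least $e$ away from $\sigma(\tau)$,
    -- and at least $(s-r)-t$. Twice the first plus the second gives the factor 3.
    have h1 := hfar r hr τ hτ
    have h2 := hζ.dist_of_le ht.1 ht.2 le_rfl
    have h3 := hζ.dist_of_le le_rfl ht.1 ht.2
    have h4 := hγ.dist_of_le hr.1 hr.2 hs.2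
    rw [hζ.right] at h2
    rw [hζ.left] at h3
    have h5 := dist_triangle (γ r) (ζ t) (σ τ)
    have h6 := dist_triangle (γ r) (ζ t) (γ s)
    have h7 := dist_triangle (γ r) (γ s) (ζ t)
    rw [dist_comm (ζ t)] at h6
    constructor <;> linarith
  have h23 : ∀ t ∈ Icc 0 e, ∀ θ ∈ Icc τ L, (e - t) + (θ - τ) ≤ 3 * dist (ζ t) (σ θ) ∧
      dist (ζ t) (σ θ) ≤ (e - t) + (θ - τ) := fun t ht θ hθ => by
    have h1 := hfar s ⟨hs.1, le_rfl⟩ θ ⟨hτ.1.trans hθ.1, hθ.2⟩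
    have h2 := hζ.dist_of_le ht.1 ht.2 le_rfl
    have h3 := hζ.dist_of_le le_rfl ht.1 ht.2
    have h4 := hσ.dist_of_le hτ.1 hθ.1 hθ.2
    rw [hζ.right] at h2
    rw [hζ.left] at h3
    have h5 := dist_triangle (γ s) (ζ t) (σ θ)
    have h6 := dist_triangle (σ τ) (ζ t) (σ θ)
    have h7 := dist_triangle (ζ t) (σ τ) (σ θ)
    rw [dist_comm (σ τ) (ζ t)] at h6
    constructor <;> linarith
  have h13 : ∀ r ∈ Icc 0 s, ∀ θ ∈ Icc τ L, (s - r) + e + (θ - τ) ≤ 5 * dist (γ r) (σ θ) ∧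
      dist (γ r) (σ θ) ≤ (s - r) + e + (θ - τ) := fun r hr θ hθ => by
    -- Both $s-r$ and $e$ are at most this distance, the former because $s\le e$; the triangle
    -- inequality for $\theta-\tau$ uses each once more, whence the factor 5.
    have h1 := hfar r hr θ ⟨hτ.1.trans hθ.1, hθ.2⟩
    have h2 := hζ.dist_eq
    have h3 := hγ.dist_of_le hr.1 hr.2 hs.2
    have h4 := hσ.dist_of_le hτ.1 hθ.1 hθ.2
    have h5 := dist_triangle4 (γ r) (γ s) (σ τ) (σ θ)
    have h6 := dist_triangle4 (σ τ) (γ s) (γ r) (σ θ)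
    rw [dist_comm (σ τ) (γ s), dist_comm (γ s) (γ r)] at h6
    have h7 := hr.1
    constructor <;> linarith
  refine ⟨by norm_num, le_rfl, fun u hu w hw huw => ?_⟩
  dsimp only
  rw [add_zero, add_zero]
  by_cases h1 : w ≤ s
  · rw [if_pos h1, if_pos (huw.trans h1), hγ.dist_of_le hu.1 huw (h1.trans hs.2)]
    constructor <;> linarith
  rw [if_neg h1]
  push Not at h1
  by_cases h2 : w ≤ s + e
  · rw [if_pos h2]
    by_cases h3 : u ≤ s
    · rw [if_pos h3]
      have := h12 u ⟨hu.1, h3⟩ (w - s) ⟨by linarith, by linarith⟩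
      constructor <;> linarith
    · push Not at h3
      rw [if_neg (not_le.2 h3), if_pos (huw.trans h2),
        hζ.dist_of_le (by linarith) (by linarith) (by linarith)]
      constructor <;> linarith
  · rw [if_neg h2]
    push Not at h2
    have hw2 := hw.2
    by_cases h3 : u ≤ s
    · rw [if_pos h3]
      have := h13 u ⟨hu.1, h3⟩ (τ + (w - s - e)) ⟨by linarith, by linarith⟩
      constructor <;> linarith
    · rw [if_neg h3]
      push Not at h3
      by_cases h4 : u ≤ s + e
      · rw [if_pos h4]
        have := h23 (u - s) ⟨by linarith, by linarith⟩ (τ + (w - s - e))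
          ⟨by linarith, by linarith⟩
        constructor <;> linarith
      · push Not at h4
        have := hτ.1
        rw [if_neg (not_le.2 h4), hσ.dist_of_le (by linarith) (by linarith) (by linarith)]
        constructor <;> linarith

lemma norm_le_of_mem_geodesic {Z : Set X} (ho : o ∈ Z) {p x : X} {γ : ℝ → X} {ℓ s : ℝ}
    (hγ : IsGeodesicSegment γ ℓ p x) (hp : p ∈ nearest x Z) (hs : s ∈ Icc 0 ℓ) :
    dist o (γ s) ≤ 2 * dist o x := by
  have h1 := hγ.dist_of_le hs.1 hs.2 le_rfl
  rw [hγ.right, dist_comm] at h1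
  have h2 := dist_triangle o x (γ s)
  have h3 : dist x p ≤ dist x o := by rw [hp.2]; exact Metric.infDist_le_dist_of_mem ho
  rw [dist_comm x p, hγ.dist_eq, dist_comm x o] at h3
  linarith [hs.1]

/-- Geodesics from `x` to points of a Morse set pass near the projection of `x`. -/
lemma IsCAT0.slim (hX : IsCAT0 X) {Z : Set X} (ho : o ∈ Z) {m : ℝ} (hm0 : 0 ≤ m)
    (hm : ∀ (f : ℝ → X) (s t : ℝ), QIOn 5 0 f (Icc s t) → f s ∈ Z → f t ∈ Z →
      ∀ u ∈ Icc s t, f u ∈ kNbhd κ o Z m)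
    {x y p : X} (hp : p ∈ nearest x Z) (hy : y ∈ Z) {σ : ℝ → X} {L : ℝ}
    (hσ : IsGeodesicSegment σ L x y) :
    ∃ θ ∈ Icc 0 L, dist p (σ θ) ≤ 4 * m * κ (dist o x) := by
  obtain ⟨γ, ℓ, hγ⟩ := hX.geodesic p x
  have hcpt := isCompact_Icc.image_of_continuousOn hσ.continuousOn
  have hne : (σ '' Icc 0 L).Nonempty := ⟨σ 0, mem_image_of_mem _ ⟨le_rfl, hσ.nonneg⟩⟩
  obtain ⟨_, ⟨θ, hθ, rfl⟩, hE⟩ := hcpt.exists_infDist_eq_dist hne p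
  refine ⟨θ, hθ, ?_⟩
  set E := dist p (σ θ)
  have hE0 : 0 ≤ E := dist_nonneg
  have hEℓ : E ≤ ℓ := by
    rw [← hE, ← hγ.dist_eq]
    exact Metric.infDist_le_dist_of_mem ⟨0, ⟨le_rfl, hσ.nonneg⟩, hσ.left⟩
  -- The detour climbs halfway, to height $E/2$, before crossing to $\sigma$: the crossing then has
  -- length at least $E/2$. The Morse property bounds the distance of the turning point from $Z$,
  -- which is exactly $E/2$ since $p$ is its projection.
  have hs : E / 2 ∈ Icc 0 ℓ := ⟨by linarith, by linarith⟩
  obtain ⟨_, ⟨τ, hτ, rfl⟩, hv⟩ := hcpt.exists_infDist_eq_dist hne (γ (E / 2))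
  obtain ⟨ζ, e, hζ⟩ := hX.geodesic (γ (E / 2)) (σ τ)
  rw [hζ.dist_eq] at hv
  have hEe : E / 2 ≤ e := by
    have h1 : Metric.infDist p (σ '' Icc 0 L) ≤
        Metric.infDist (γ (E / 2)) (σ '' Icc 0 L) + dist p (γ (E / 2)) :=
      Metric.infDist_le_infDist_add_dist
    rw [(hγ.initial hs).dist_eq] at h1
    linarith
  have hfar : ∀ r ∈ Icc 0 (E / 2), ∀ θ ∈ Icc 0 L, e ≤ dist (γ r) (σ θ) := fun r hr θ hθ => by
    rw [← hv]
    exact (hX.infDist_anti hγ hσ hr.1 hr.2 hs.2).trans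
      (Metric.infDist_le_dist_of_mem (mem_image_of_mem _ hθ))
  have hP := hm _ _ _ (qiOn_detour hγ hσ hζ hs hτ rfl rfl hEe hfar) (by
      rw [if_pos hs.1, hγ.left]; exact hp.1) (by
      have hτ2 := hτ.2
      -- When the crossing or the last piece degenerates, the end time falls into an earlier branch
      -- of the path, but the end point is still $y$.
      by_cases h1 : E / 2 + e + (L - τ) ≤ E / 2
      · have h2 : L = τ := by linarith [hζ.nonneg]
        have h3 : e = 0 := by linarith [hζ.nonneg]
        have h4 : γ (E / 2) = σ τ := by rw [← hζ.left, ← hζ.right, h3]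
        rw [if_pos h1, h2, sub_self, h3, add_zero, add_zero, h4, ← h2, hσ.right]
        exact hy
      · rw [if_neg h1]
        by_cases h2 : E / 2 + e + (L - τ) ≤ E / 2 + e
        · have h3 : L = τ := by linarith
          rw [if_pos h2, h3, sub_self, add_zero, add_sub_cancel_left, hζ.right, ← h3, hσ.right]
          exact hy
        · rw [if_neg h2, show τ + (E / 2 + e + (L - τ) - E / 2 - e) = L by ring, hσ.right]
          exact hy) (E / 2) ⟨hs.1, by linarith [hζ.nonneg, hτ.2]⟩
  simp only [le_refl, if_true, kNbhd, mem_ofPred_eq] at hP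
  rw [hγ.infDist_eq hp hs] at hP
  have h1 := κ.le_of_dist_le one_le_two (norm_le_of_mem_geodesic ho hγ hp hs)
  have h2 := mul_le_mul_of_nonneg_left h1 hm0
  linarith

/-- In CAT(0) spaces, Morse sets are contracting. -/
theorem IsCAT0.isContracting (hX : IsCAT0 X) {Z : Set X} (ho : o ∈ Z)
    (hZ : CoarselyMorse κ o Z) : IsContracting κ o Z := by
  obtain ⟨m', hm'⟩ := hZ 5 0 0
  set m := |m'|
  have hm0 : 0 ≤ m := abs_nonneg _
  have hm : ∀ (f : ℝ → X) (s t : ℝ), QIOn 5 0 f (Icc s t) → f s ∈ Z → f t ∈ Z →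
      ∀ u ∈ Icc s t, f u ∈ kNbhd κ o Z m := fun f s t hf hs ht u hu =>
    kNbhd_mono (le_abs_self _)
      (hm' f s t hf (subset_kNbhd le_rfl hs) (subset_kNbhd le_rfl ht) u hu)
  have main : ∀ x y : X, dist x y ≤ Metric.infDist x Z → ∀ p ∈ nearest x Z, ∀ p' ∈ nearest y Z,
      dist p p' ≤ 24 * m * κ (dist o x) := by
    intro x y hxy p hp p' hp'
    -- The geodesic from $y$ to $p$ passes near $p'$. The homothety centred at $p$ that takes $y$
    -- there takes $x$ to $z=\gamma(c\ell)$, so $d(z,p')$ is at most $c\ell=d(z,p)$ up to a small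
    -- error. But the geodesic from $z$ to $p'$ passes near $p$, so $d(z,p')$ is nearly
    -- $d(z,p)+d(p,p')$. Three errors of at most $8m\kappa(x)$ add up to the bound.
    obtain ⟨σ, L, hσ⟩ := hX.geodesic y p
    obtain ⟨θ, hθ, hv⟩ := hX.slim ho hm0 hm hp' hp.1 hσ
    obtain ⟨γ, ℓ, hγ⟩ := hX.geodesic p x
    -- the factor that takes `y` to the point near its projection
    obtain ⟨c, hc, hcL⟩ : ∃ c ∈ Icc (0 : ℝ) 1, L - c * L = θ := by
      rcases hσ.nonneg.eq_or_lt with h0 | h0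
      · exact ⟨0, ⟨le_rfl, zero_le_one⟩, by linarith [hθ.1, hθ.2]⟩
      · exact ⟨(L - θ) / L, ⟨div_nonneg (by linarith [hθ.2]) h0.le,
          (div_le_one h0).2 (by linarith [hθ.1])⟩, by field_simp; ring⟩
    have h1 := hX.dist_homothety_le hγ hσ.reverse hc
    simp only [hcL] at h1
    have hcl : c * ℓ ∈ Icc 0 ℓ :=
      ⟨mul_nonneg hc.1 hγ.nonneg, mul_le_of_le_one_left hγ.nonneg hc.2⟩
    obtain ⟨ω, W, hω⟩ := hX.geodesic (γ (c * ℓ)) p'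
    obtain ⟨φ, hφ, hw⟩ := hX.slim ho hm0 hm (hγ.mem_nearest hp hcl) hp'.1 hω
    have hxp : Metric.infDist x Z = ℓ := by rw [← hp.2, dist_comm, hγ.dist_eq]
    rw [hxp] at hxy
    have hxo : ℓ ≤ dist o x := by
      rw [← hxp, dist_comm]; exact Metric.infDist_le_dist_of_mem ho
    have hκx := κ.pos (dist_nonneg (x := o) (y := x))
    have hκy := κ.le_of_dist_le (o := o) (x := x) (y := y) one_le_two (by
      have := dist_triangle o x y; linarith)
    have hκc := κ.le_of_dist_le one_le_two (norm_le_of_mem_geodesic ho hγ hp hcl)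
    have h2 : c * dist x y ≤ c * ℓ := mul_le_mul_of_nonneg_left hxy hc.1
    have h3 := hω.dist_of_le le_rfl hφ.1 hφ.2
    have h4 := hω.dist_of_le hφ.1 hφ.2 le_rfl
    rw [hω.left] at h3
    rw [hω.right] at h4
    have h5 : dist p (γ (c * ℓ)) = c * ℓ := (hγ.initial hcl).dist_eq
    have h6 := dist_triangle p (ω φ) (γ (c * ℓ))
    have h7 := dist_triangle p (ω φ) p'
    have h8 := dist_triangle (γ (c * ℓ)) (σ θ) p'
    rw [hω.dist_eq] at h8
    rw [dist_comm (ω φ) (γ (c * ℓ))] at h6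
    rw [dist_comm (σ θ) p'] at h8
    have h9 := mul_le_mul_of_nonneg_left hκy (show 0 ≤ 4 * m by linarith)
    have h10 := mul_le_mul_of_nonneg_left hκc (show 0 ≤ 4 * m by linarith)
    linarith
  -- The doubling covers two projections of $y$, where the bound is in $\kappa(y)\le 2\kappa(x)$.
  refine ⟨48 * m, fun x y hxy u hu v hv => ?_⟩
  have hκx := κ.pos (dist_nonneg (x := o) (y := x))
  have hmκ : 0 ≤ m * κ.toFun (dist o x) := mul_nonneg hm0 hκx.le
  have hxx : dist x x ≤ Metric.infDist x Z := by rw [dist_self]; exact Metric.infDist_nonneg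
  have hyy : dist y y ≤ Metric.infDist y Z := by rw [dist_self]; exact Metric.infDist_nonneg
  rcases hu with hu | hu <;> rcases hv with hv | hv
  · linarith [main x x hxx u hu v hv]
  · linarith [main x y hxy u hu v hv]
  · rw [dist_comm]
    linarith [main x y hxy v hv u hu]
  · have hκy := κ.le_of_dist_le (o := o) (x := x) (y := y) one_le_two (by
      have h1 := dist_triangle o x y
      have h2 : Metric.infDist x Z ≤ dist x o := Metric.infDist_le_dist_of_mem ho
      rw [dist_comm x o] at h2
      linarith)
    have := mul_le_mul_of_nonneg_left hκy (show 0 ≤ 24 * m by linarith)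
    linarith [main y y hyy u hu v hv]

end MorseContracting

/-! ### Invariance under coarse equivalences -/

section CoarseEquiv

variable {X Y : Type*} [MetricSpace X] [MetricSpace Y]

/-- `Φ` and `Ψ` are coarsely Lipschitz and coarsely inverse to each other. -/
structure IsCoarseEquiv (L : ℝ) (Φ : X → Y) (Ψ : Y → X) : Prop where
  one_le : 1 ≤ L
  map : ∀ x x', dist (Φ x) (Φ x') ≤ L * dist x x' + L
  inv : ∀ y y', dist (Ψ y) (Ψ y') ≤ L * dist y y' + L
  left : ∀ x, dist (Ψ (Φ x)) x ≤ L
  right : ∀ y, dist (Φ (Ψ y)) y ≤ L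

variable {κ : SublinearFunction} {o : X} {o' : Y} {L : ℝ} {Φ : X → Y} {Ψ : Y → X}

namespace IsCoarseEquiv

lemma refl (X : Type*) [MetricSpace X] : IsCoarseEquiv 1 (id : X → X) id where
  one_le := le_rfl
  map x y := by simp
  inv x y := by simp
  left x := by simp
  right x := by simp

lemma symm (h : IsCoarseEquiv L Φ Ψ) : IsCoarseEquiv L Ψ Φ :=
  ⟨h.one_le, h.inv, h.map, h.right, h.left⟩

lemma dist_le (h : IsCoarseEquiv L Φ Ψ) (x x' : X) :
    dist x x' ≤ L * dist (Φ x) (Φ x') + 3 * L := by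
  have h1 := dist_triangle4 x (Ψ (Φ x)) (Ψ (Φ x')) x'
  have h2 := h.left x
  have h3 := h.left x'
  have h4 := h.inv (Φ x) (Φ x')
  rw [dist_comm] at h2
  linarith

lemma qiOn (h : IsCoarseEquiv L Φ Ψ) {q Q : ℝ} {f : ℝ → X} {s : Set ℝ} (hf : QIOn q Q f s) :
    QIOn (L * q) (L * Q + 3 * L) (fun t => Φ (f t)) s := by
  obtain ⟨hq, hQ, hf⟩ := hf
  have hL := h.one_le
  have hL2 : L ≤ L * L := le_mul_of_one_le_left (by linarith) hL
  have hLQ : Q ≤ L * (L * Q) := by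
    rw [← mul_assoc]
    exact le_mul_of_one_le_left hQ (by linarith)
  refine ⟨by nlinarith, by nlinarith, fun u hu v hv huv => ⟨?_, ?_⟩⟩
  · have h1 := (hf u hu v hv huv).1
    have h2 := h.dist_le (f u) (f v)
    have h3 : q * (dist (f u) (f v) + Q) ≤ q * (L * (dist (Φ (f u)) (Φ (f v)) + (L * Q + 3 * L))) :=
      mul_le_mul_of_nonneg_left (by linarith) (by linarith)
    linarith
  · have h1 := (hf u hu v hv huv).2
    have h2 := h.map (f u) (f v)
    have h3 := mul_le_mul_of_nonneg_left h1 (show 0 ≤ L by linarith)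
    linarith

lemma isQIEmbedding (h : IsCoarseEquiv L Φ Ψ) {q Q : ℝ} {f : ℝ≥0 → X}
    (hf : IsQIEmbedding q Q f) : IsQIEmbedding (L * q) (L * Q + 3 * L) (fun t => Φ (f t)) := by
  obtain ⟨hq, hQ, hf⟩ := hf
  have hL := h.one_le
  have hL2 : L ≤ L * L := le_mul_of_one_le_left (by linarith) hL
  have hLQ : Q ≤ L * (L * Q) := by
    rw [← mul_assoc]
    exact le_mul_of_one_le_left hQ (by linarith)
  refine ⟨by nlinarith, by nlinarith, fun u v => ⟨?_, ?_⟩⟩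
  · have h1 := (hf u v).1
    have h2 := h.dist_le (f u) (f v)
    have h3 : 1 / (L * q) * dist u v = (1 / L) * (1 / q * dist u v) := by field_simp
    rw [h3, sub_le_iff_le_add, one_div L, inv_mul_le_iff₀ (by linarith)]
    linarith
  · have h1 := (hf u v).2
    have h2 := h.map (f u) (f v)
    have h3 := mul_le_mul_of_nonneg_left h1 (show 0 ≤ L by linarith)
    linarith

/-- Points near the image of a `κ`-neighbourhood of `Z` are in a `κ`-neighbourhood of `Z'` if the
image of `Z` is. -/
lemma exists_kNbhd (h : IsCoarseEquiv L Φ Ψ) {Z : Set X} {Z' : Set Y} (hne : Z.Nonempty)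
    (hZ : ∃ k : ℝ, Φ '' Z ⊆ kNbhd κ o' Z' k) (n C : ℝ) :
    ∃ n' : ℝ, ∀ x ∈ kNbhd κ o Z n, ∀ y : Y, dist y (Φ x) ≤ C → y ∈ kNbhd κ o' Z' n' := by
  have hL := h.one_le
  set B : ℝ := L * (dist (Φ o) o' + |C|) + 3 * L with hB
  have hB0 : 0 ≤ B := by positivity
  have hκB := κ.pos hB0
  set n₁ : ℝ := (|C| + L * (|n| + 1) + L) * (L + κ B) with hn₁
  have key : {y : Y | ∃ x ∈ kNbhd κ o Z n, dist y (Φ x) ≤ C} ⊆ kNbhd κ o' (Φ '' Z) n₁ := by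
    rintro y ⟨x, hx, hxy⟩
    have hκx := κ.one_le _ (dist_nonneg (x := o) (y := x))
    have hκy := κ.one_le _ (dist_nonneg (x := o') (y := y))
    have h1 : Metric.infDist x Z < (|n| + 1) * κ.toFun (dist o x) := by
      simp only [kNbhd, mem_ofPred_eq] at hx
      have := le_abs_self n
      nlinarith
    obtain ⟨z, hz, hxz⟩ := (Metric.infDist_lt_iff hne).1 h1
    have h2 : Metric.infDist y (Φ '' Z) ≤ dist y (Φ z) :=
      Metric.infDist_le_dist_of_mem (mem_image_of_mem _ hz)
    have h3 := dist_triangle y (Φ x) (Φ z)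
    have h4 := h.map x z
    have h5 : dist y (Φ z) ≤ (|C| + L * (|n| + 1) + L) * κ.toFun (dist o x) := by
      have := mul_le_mul_of_nonneg_left hxz.le (show 0 ≤ L by linarith)
      have := le_abs_self C
      have := le_mul_of_one_le_right (abs_nonneg C) hκx
      have := le_mul_of_one_le_right (show 0 ≤ L by linarith) hκx
      linarith
    have h6 : dist o x ≤ L * dist o' y + B := by
      have h7 := h.dist_le o x
      have h8 := dist_triangle4 (Φ o) o' y (Φ x)
      have h9 : dist (Φ o) (Φ x) ≤ dist (Φ o) o' + |C| + dist o' y := by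
        linarith [le_abs_self C]
      have := mul_le_mul_of_nonneg_left h9 (show 0 ≤ L by linarith)
      linarith
    have h7 : κ.toFun (dist o x) ≤ (L + κ B) * κ.toFun (dist o' y) := by
      have hLd : 0 ≤ L * dist o' y := mul_nonneg (by linarith) dist_nonneg
      have h8 := κ.mono (mem_Ici.2 dist_nonneg) (mem_Ici.2 (add_nonneg hLd hB0)) h6
      have h9 := κ.add_le hLd hB0
      have h10 := κ.mul_le hL (dist_nonneg (x := o') (y := y))
      have h11 := le_mul_of_one_le_right hκB.le hκy
      linarith
    have h8 := mul_le_mul_of_nonneg_left h7 (show 0 ≤ |C| + L * (|n| + 1) + L by positivity)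
    simp only [kNbhd, mem_ofPred_eq]
    linarith
  obtain ⟨n', hn'⟩ := kNbhd_trans κ (hne.image Φ) ⟨n₁, key⟩ hZ
  exact ⟨n', fun x hx y hxy => hn' ⟨x, hx, hxy⟩⟩

lemma close_image (h : IsCoarseEquiv L Φ Ψ) {A B : Set X} (hA : A.Nonempty) (hB : B.Nonempty)
    (hAB : Close κ o A B) : Close κ o' (Φ '' A) (Φ '' B) := by
  have key : ∀ A B : Set X, B.Nonempty → (∃ n : ℝ, A ⊆ kNbhd κ o B n) →
      ∃ n : ℝ, Φ '' A ⊆ kNbhd κ o' (Φ '' B) n := fun A B hB ⟨n, hn⟩ => by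
    obtain ⟨n', hn'⟩ := h.exists_kNbhd (κ := κ) (o := o) (o' := o') hB
      ⟨0, subset_kNbhd le_rfl⟩ n 0
    refine ⟨n', ?_⟩
    rintro _ ⟨x, hx, rfl⟩
    exact hn' x (hn hx) _ (by rw [dist_self])
  exact ⟨key A B hB hAB.1, key B A hA hAB.2⟩

lemma close_symm (h : IsCoarseEquiv L Φ Ψ) {Z : Set X} {Z' : Set Y} (hZ : Z.Nonempty)
    (hZ' : Z'.Nonempty) (hc : Close κ o' (Φ '' Z) Z') : Close κ o (Ψ '' Z') Z := by
  constructor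
  · obtain ⟨n, hn⟩ := hc.2
    obtain ⟨n', hn'⟩ := h.symm.exists_kNbhd (κ := κ) (o := o') (o' := o) (Z := Φ '' Z) (Z' := Z)
      (hZ.image Φ) ⟨|L|, subset_kNbhd_of_bounded (by
        rintro _ ⟨_, ⟨z, hz, rfl⟩, rfl⟩
        exact ⟨z, hz, h.left z⟩)⟩ n 0
    refine ⟨n', ?_⟩
    rintro _ ⟨z, hz, rfl⟩
    exact hn' z (hn hz) _ (by rw [dist_self])
  · obtain ⟨n, hn⟩ := hc.1
    obtain ⟨n', hn'⟩ := h.symm.exists_kNbhd (κ := κ) (o := o') (o' := o) hZ'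
      ⟨0, subset_kNbhd le_rfl⟩ n L
    exact ⟨n', fun z hz => hn' (Φ z) (hn (mem_image_of_mem _ hz)) z
      (by rw [dist_comm]; exact h.left z)⟩

/-- The coarse Morse property is invariant under coarse equivalences. -/
lemma coarselyMorse (h : IsCoarseEquiv L Φ Ψ) {Z : Set X} {Z' : Set Y} (hne : Z.Nonempty)
    (hne' : Z'.Nonempty) (hZ : CoarselyMorse κ o Z) (hc : Close κ o' (Φ '' Z) Z') :
    CoarselyMorse κ o' Z' := by
  intro q Q n
  obtain ⟨n₁, hn₁⟩ := h.symm.exists_kNbhd (κ := κ) (o := o') (o' := o) hne'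
    (h.close_symm hne hne' hc).1 n 0
  obtain ⟨m₁, hm₁⟩ := hZ (L * q) (L * Q + 3 * L) n₁
  obtain ⟨m, hm⟩ := h.exists_kNbhd (κ := κ) (o := o) (o' := o') hne hc.1 m₁ L
  refine ⟨m, fun f s t hf hs ht u hu => ?_⟩
  -- The path is pulled back by $\Psi$, which may destroy continuity; the coarse Morse property does
  -- not ask for it.
  have h1 := hm₁ _ s t (h.symm.qiOn hf) (hn₁ _ hs _ (by rw [dist_self]))
    (hn₁ _ ht _ (by rw [dist_self])) u hu
  exact hm _ h1 _ (by rw [dist_comm]; exact h.right _)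

end IsCoarseEquiv

end CoarseEquiv

/-! ### Geodesic rays close to Morse quasi-geodesic rays -/

section Rays

variable {X : Type*} [MetricSpace X] {κ : SublinearFunction} {o : X}

lemma CoarselyMorse.congr {A B : Set X} (hA : A.Nonempty) (hB : B.Nonempty)
    (h : CoarselyMorse κ o A) (hAB : Close κ o A B) : CoarselyMorse κ o B :=
  (IsCoarseEquiv.refl X).coarselyMorse hA hB h (by rwa [image_id])

/-- If a quasi-geodesic ray `g` is in a `κ`-neighbourhood of a quasi-geodesic ray `f`, then `f` is
in a `κ`-neighbourhood of `g`. -/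
lemma close_of_subset {q Q q' Q' : ℝ} {f g : ℝ≥0 → X} (hf : IsQIEmbedding q Q f)
    (hg : IsQIEmbedding q' Q' g) (h : ∃ n : ℝ, range g ⊆ kNbhd κ o (range f) n) :
    Close κ o (range g) (range f) := by
  refine ⟨h, ?_⟩
  obtain ⟨n₀, hn₀⟩ := h
  -- The last summand allows time 0 of $f$ to be matched with time 0 of $g$; the 1 gives a strict
  -- inequality.
  set n : ℝ := |n₀| + 1 + dist (g 0) (f 0) with hn
  have hn1 : 1 ≤ n := by
    have := abs_nonneg n₀
    have := dist_nonneg (x := g 0) (y := f 0)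
    linarith
  have hτ : ∀ k : ℕ, ∃ τ : ℝ≥0, dist (g k) (f τ) ≤ n * κ (dist o (g k)) := fun k => by
    have h1 := hn₀ (mem_range_self (k : ℝ≥0))
    have hκ := κ.one_le _ (dist_nonneg (x := o) (y := g k))
    have h2 : Metric.infDist (g k) (range f) < n * κ.toFun (dist o (g k)) := by
      simp only [kNbhd, mem_ofPred_eq] at h1
      have h3 := mul_le_mul_of_nonneg_right (le_abs_self n₀)
        (show 0 ≤ κ.toFun (dist o (g k)) by linarith)
      have := mul_nonneg (dist_nonneg (x := g 0) (y := f 0))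
        (show 0 ≤ κ.toFun (dist o (g k)) by linarith)
      rw [hn, add_mul, add_mul]
      linarith
    obtain ⟨_, ⟨τ, rfl⟩, h3⟩ := (Metric.infDist_lt_iff (range_nonempty f)).1 h2
    exact ⟨τ, h3.le⟩
  choose τ' hτ' using hτ
  -- a choice that starts at time 0
  set τ : ℕ → ℝ≥0 := fun k => if k = 0 then 0 else τ' k with hτdef
  have hτ : ∀ k : ℕ, dist (g k) (f (τ k)) ≤ n * κ.toFun (dist o (g k)) := fun k => by
    by_cases hk : k = 0
    · subst hk
      simp only [hτdef, if_true, Nat.cast_zero]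
      have hκ := κ.one_le _ (dist_nonneg (x := o) (y := g 0))
      have : dist (g 0) (f 0) ≤ n := by rw [hn]; linarith [abs_nonneg n₀]
      nlinarith
    · simp only [hτdef, if_neg hk]
      exact hτ' k
  have hτ0 : τ 0 = 0 := by simp [hτdef]
  obtain ⟨hq, hQ, hfq⟩ := hf
  obtain ⟨hq', hQ', hgq⟩ := hg
  -- the times are unbounded
  have hunb : ∀ t : ℝ≥0, ∃ k, t < τ k := by
    intro t
    by_contra! hle
    obtain ⟨B, hB, hb⟩ := κ.exists_mul_le n (show (0 : ℝ) < 1 / 2 by norm_num)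
    have hbound : ∀ k : ℕ, dist o (g k) ≤ 2 * (dist o (f 0) + (q * t + Q) + B) := fun k => by
      have h1 := hτ k
      have h2 := hb _ (dist_nonneg (x := o) (y := g k))
      have h3 := (hfq 0 (τ k)).2
      have h4 : dist 0 (τ k) ≤ t := by
        rw [NNReal.dist_eq, NNReal.coe_zero, zero_sub, abs_neg, NNReal.abs_eq]
        exact_mod_cast hle k
      have h5 := mul_le_mul_of_nonneg_left h4 (show 0 ≤ q by linarith)
      have h6 := dist_triangle4 o (f 0) (f (τ k)) (g k)
      rw [dist_comm (f (τ k))] at h6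
      linarith
    obtain ⟨k, hk⟩ := exists_nat_gt (q' * (2 * (dist o (f 0) + (q * t + Q) + B) + dist o (g 0) + Q'))
    have h1 := (hgq 0 k).1
    have h2 : dist (0 : ℝ≥0) k = k := by
      rw [NNReal.dist_eq, NNReal.coe_zero, zero_sub, abs_neg, NNReal.abs_eq, NNReal.coe_natCast]
    have h3 := hbound k
    have h4 := dist_triangle (g 0) o (g k)
    rw [dist_comm (g 0) o] at h4
    rw [h2] at h1
    have h5 : 1 / q' * (k : ℝ) ≤ 2 * (dist o (f 0) + (q * t + Q) + B) + dist o (g 0) + Q' := by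
      linarith
    rw [one_div, inv_mul_le_iff₀ (by linarith)] at h5
    linarith
  set J : ℝ := n + (q' + Q') + n * ((1 + (q' + Q') * κ 1)) with hJ
  set K : ℝ := q * (q * (J + Q)) + Q + n with hK
  obtain ⟨C, hC, hcomp⟩ := κ.exists_compare K
  refine ⟨K * C, ?_⟩
  rintro _ ⟨t, rfl⟩
  -- A discrete intermediate value argument: the matched times start at 0 and are unbounded, though
  -- perhaps not monotone. As $g(k)$ and $g(k+1)$ are near each other, so are $\tau_k$ and
  -- $\tau_{k+1}$, up to a multiple of $\kappa(g(k))$.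
  obtain ⟨k, hk1, hk2⟩ : ∃ k, τ k ≤ t ∧ t < τ (k + 1) := by
    classical
    have hex := hunb t
    have hpos : Nat.find hex ≠ 0 := fun h0 => by
      have := Nat.find_spec hex
      rw [h0, hτ0] at this
      exact not_lt.2 (zero_le (a := t)) this
    obtain ⟨k, hk⟩ := Nat.exists_eq_succ_of_ne_zero hpos
    refine ⟨k, not_lt.1 (Nat.find_min hex (by omega)), ?_⟩
    have := Nat.find_spec hex
    rwa [hk] at this
  have hκ := κ.one_le _ (dist_nonneg (x := o) (y := g k))
  have hκ1 := κ.pos zero_le_one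
  have hgg : dist (g k) (g (k + 1 : ℕ)) ≤ q' + Q' := by
    have h1 := (hgq k (k + 1 : ℕ)).2
    have h2 : dist (k : ℝ≥0) ((k + 1 : ℕ) : ℝ≥0) = 1 := by
      rw [NNReal.dist_eq]; simp
    rwa [h2, mul_one] at h1
  have hgg' : dist (g k) (g (k + 1 : ℕ)) ≤ (q' + Q') * κ.toFun (dist o (g k)) :=
    hgg.trans (le_mul_of_one_le_right (by linarith) hκ)
  have hκ' := κ.compare o (by linarith) hgg'
  have hff : dist (f (τ k)) (f (τ (k + 1))) ≤ J * κ.toFun (dist o (g k)) := by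
    have h1 := dist_triangle4 (f (τ k)) (g k) (g (k + 1 : ℕ)) (f (τ (k + 1)))
    have h2 := hτ k
    have h3 := hτ (k + 1)
    rw [dist_comm (f (τ k)) (g k)] at h1
    have h4 := mul_le_mul_of_nonneg_left hκ' (show 0 ≤ n by linarith)
    rw [hJ]
    linarith
  have hJ0 : 0 ≤ J := by
    have : 0 ≤ n * (1 + (q' + Q') * κ.toFun 1) := by positivity
    linarith
  have hdt : dist t (τ k) ≤ dist (τ k) (τ (k + 1)) := by
    rw [NNReal.dist_eq, NNReal.dist_eq, abs_sub_comm (τ k : ℝ)]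
    have h1 : (τ k : ℝ) ≤ t := hk1
    have h2 : (t : ℝ) < τ (k + 1) := hk2
    rw [abs_of_nonneg (by linarith), abs_of_nonneg (by linarith)]
    linarith
  have hττ : dist (τ k) (τ (k + 1)) ≤ q * (J * κ.toFun (dist o (g k)) + Q) := by
    have h1 := (hfq (τ k) (τ (k + 1))).1
    have h2 : 1 / q * dist (τ k) (τ (k + 1)) ≤ J * κ.toFun (dist o (g k)) + Q := by linarith
    rwa [one_div, inv_mul_le_iff₀ (by linarith)] at h2
  have hfin : dist (f t) (g k) ≤ K * κ.toFun (dist o (g k)) := by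
    have h1 := (hfq t (τ k)).2
    have h2 := mul_le_mul_of_nonneg_left (hdt.trans hττ) (show 0 ≤ q by linarith)
    have h3 := hτ k
    have h4 := dist_triangle (f t) (f (τ k)) (g k)
    rw [dist_comm (f (τ k))] at h4
    have h5 : Q ≤ Q * κ.toFun (dist o (g k)) := le_mul_of_one_le_right hQ hκ
    have h6 : q * (q * Q) ≤ q * (q * Q) * κ.toFun (dist o (g k)) :=
      le_mul_of_one_le_right (by positivity) hκ
    rw [hK]
    linarith
  have hfin' := hcomp o _ _ hfin
  have hK0 : 0 ≤ K := by positivity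
  simp only [kNbhd, mem_ofPred_eq]
  calc Metric.infDist (f t) (range g) ≤ dist (f t) (g k) :=
        Metric.infDist_le_dist_of_mem (mem_range_self _)
    _ ≤ K * κ.toFun (dist o (g k)) := hfin
    _ ≤ K * (C * κ.toFun (dist o (f t))) := mul_le_mul_of_nonneg_left hfin' hK0
    _ = K * C * κ.toFun (dist o (f t)) := by ring

lemma IsGeodesicSegment.qiOn {γ : ℝ → X} {ℓ : ℝ} {x y : X} (h : IsGeodesicSegment γ ℓ x y) :
    QIOn 1 0 γ (Icc 0 ℓ) := by
  refine ⟨le_rfl, le_rfl, fun u hu v hv huv => ?_⟩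
  rw [h.dist_of_le hu.1 huv hv.2]
  constructor <;> linarith

lemma isQIEmbedding_of_isometry {b : ℝ≥0 → X} (hb : Isometry b) : IsQIEmbedding 1 0 b := by
  refine ⟨le_rfl, le_rfl, fun x y => ?_⟩
  rw [hb.dist_eq]
  constructor <;> linarith

/-- A coarse quasi-geodesic ray with the Morse property is close to a geodesic ray from the
base-point. -/
theorem exists_geodesic_ray [ProperSpace X] (hX : IsCAT0 X) {q Q : ℝ} {f : ℝ≥0 → X}
    (hf : IsQIEmbedding q Q f) (hM : CoarselyMorse κ o (range f)) :
    ∃ b : QRay o, Isometry b ∧ Close κ o (range b) (range f) := by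
  choose γ ℓ hγ using fun n : ℕ => hX.geodesic o (f n)
  -- The base-point need not lie on $f$; this neighbourhood contains it.
  obtain ⟨m, hm⟩ := hM 1 0 (dist o (f 0))
  have hγm : ∀ n, ∀ u ∈ Icc 0 (ℓ n), γ n u ∈ kNbhd κ o (range f) m := fun n u hu => by
    refine hm (γ n) 0 (ℓ n) (hγ n).qiOn ?_ ?_ u hu
    · rw [(hγ n).left]
      simp only [kNbhd, mem_ofPred_eq]
      have h1 := κ.one_le _ (dist_nonneg (x := o) (y := o))
      have h2 : Metric.infDist o (range f) ≤ dist o (f 0) :=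
        Metric.infDist_le_dist_of_mem (mem_range_self 0)
      have h3 := dist_nonneg (x := o) (y := f 0)
      nlinarith
    · rw [(hγ n).right]
      exact subset_kNbhd dist_nonneg (mem_range_self _)
  have hlen : ∀ t : ℝ, ∀ᶠ n in (hyperfilter ℕ : Filter ℕ), t ≤ ℓ n := fun t => by
    refine Filter.Eventually.filter_mono (hyperfilter_le_cofinite.trans Nat.cofinite_eq_atTop.le) ?_
    obtain ⟨N, hN⟩ := exists_nat_ge (q * (t + dist o (f 0) + Q))
    filter_upwards [eventually_ge_atTop N] with n hn
    have hn' : (N : ℝ) ≤ n := by exact_mod_cast hn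
    have h1 := (hf.2.2 0 n).1
    have h2 : dist (0 : ℝ≥0) n = n := by
      rw [NNReal.dist_eq, NNReal.coe_zero, zero_sub, abs_neg, NNReal.abs_eq, NNReal.coe_natCast]
    have h3 := dist_triangle_left (f 0) (f n) o
    have h4 := (hγ n).dist_eq
    have h5 : t + dist o (f 0) + Q ≤ 1 / q * (n : ℝ) := by
      rw [one_div, le_inv_mul_iff₀ (by linarith [hf.1])]
      linarith
    rw [h2] at h1
    linarith
  -- Balls are compact, so an ultrafilter gives limits at all times at once and replaces a diagonal
  -- argument.
  have hlim : ∀ t : ℝ≥0, ∃ x, Tendsto (fun n => γ n t) (hyperfilter ℕ : Filter ℕ) (𝓝 x) := by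
    intro t
    have hball : ∀ᶠ n in (hyperfilter ℕ : Filter ℕ), γ n t ∈ Metric.closedBall o t := by
      filter_upwards [hlen t] with n hn
      rw [Metric.mem_closedBall, dist_comm, ((hγ n).initial ⟨t.coe_nonneg, hn⟩).dist_eq]
    obtain ⟨x, -, hx⟩ := (isCompact_closedBall o (t : ℝ)).ultrafilter_le_nhds
      ((hyperfilter ℕ).map fun n => γ n t) (le_principal_iff.2 hball)
    exact ⟨x, hx⟩
  choose b hb using hlim
  have hiso : Isometry b := Isometry.of_dist_eq fun s t => by
    refine tendsto_nhds_unique ((hb s).dist (hb t)) ?_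
    refine Tendsto.congr' ?_ tendsto_const_nhds
    filter_upwards [hlen s, hlen t] with n hs ht
    rw [(hγ n).isom s ⟨s.2, hs⟩ t ⟨t.2, ht⟩, NNReal.dist_eq]
  have hb0 : b 0 = o := by
    refine tendsto_nhds_unique (hb 0) ?_
    simp only [NNReal.coe_zero, (hγ _).left]
    exact tendsto_const_nhds
  refine ⟨⟨b, hiso.continuous, hb0, 1, 0, isQIEmbedding_of_isometry hiso⟩, hiso,
    close_of_subset hf (isQIEmbedding_of_isometry hiso) ⟨m, ?_⟩⟩
  rintro _ ⟨t, rfl⟩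
  have h1 : Tendsto (fun n => Metric.infDist (γ n t) (range f)) (hyperfilter ℕ : Filter ℕ)
      (𝓝 (Metric.infDist (b t) (range f))) :=
    ((Metric.continuous_infDist_pt _).tendsto _).comp (hb t)
  -- Eventually $\gamma_n(t)$ and $b(t)$ both have norm $t$, so the bound is constant and no
  -- continuity of $\kappa$ is needed.
  refine le_of_tendsto h1 ?_
  filter_upwards [hlen t] with n hn
  have h2 := hγm n t ⟨t.2, hn⟩
  simp only [kNbhd, mem_ofPred_eq] at h2
  have h3 : dist o (b t) = t := by
    rw [← hb0, hiso.dist_eq, NNReal.dist_eq, NNReal.coe_zero, zero_sub, abs_neg, NNReal.abs_eq]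
  rw [((hγ n).initial ⟨t.coe_nonneg, hn⟩).dist_eq] at h2
  rwa [h3]

end Rays

/-! ### Coarse equivalence from two actions of one group -/

section GroupActions

/-- On orbits, bounded distances in one space give bounded distances in the other. -/
lemma exists_orbit_bound {G : Type*} [Group G] {X₁ : Type*} [MetricSpace X₁] [ProperSpace X₁]
    [MulAction G X₁] {X₂ : Type*} [MetricSpace X₂] [MulAction G X₂]
    (h₁ : ActsQuasiGeometrically G X₁) (h₂ : ActsQuasiGeometrically G X₂) (o₁ : X₁) (o₂ : X₂)
    (T : ℝ) : ∃ T' : ℝ, 0 ≤ T' ∧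
      ∀ g h : G, dist (g • o₁) (h • o₁) ≤ T → dist (g • o₂) (h • o₂) ≤ T' := by
  obtain ⟨k₁, K₁, hq₁⟩ := h₁.quasiIsometric
  obtain ⟨k₂, K₂, hq₂⟩ := h₂.quasiIsometric
  have hk₁ := (hq₁ 1).1.1
  have hk₂ := (hq₂ 1).1.1
  have hK₂ := (hq₂ 1).1.2.1
  -- The element $g^{-1}h$ moves $o_1$ within this ball, so it belongs to a finite set that does not
  -- depend on $g$ and $h$.
  have hfin := h₁.discrete (Metric.closedBall o₁ |k₁ * (T + K₁)|) (isCompact_closedBall _ _)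
  obtain ⟨B, hB⟩ := (hfin.image fun g : G => dist o₂ (g • o₂)).bddAbove
  refine ⟨k₂ * |B| + K₂, by positivity, fun g h hgh => ?_⟩
  have h1 := ((hq₁ g).1.2.2 o₁ ((g⁻¹ * h) • o₁)).1
  have h2 := ((hq₂ g).1.2.2 o₂ ((g⁻¹ * h) • o₂)).2
  simp only [smul_smul, mul_inv_cancel_left] at h1 h2
  have h3 : 1 / k₁ * dist o₁ ((g⁻¹ * h) • o₁) ≤ T + K₁ := by linarith
  rw [one_div, inv_mul_le_iff₀ (by linarith)] at h3
  have h4 : g⁻¹ * h ∈ {g : G | (((fun x => g • x) '' Metric.closedBall o₁ |k₁ * (T + K₁)|) ∩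
      Metric.closedBall o₁ |k₁ * (T + K₁)|).Nonempty} :=
    ⟨(g⁻¹ * h) • o₁, mem_image_of_mem _ (Metric.mem_closedBall_self (abs_nonneg _)), by
      rw [Metric.mem_closedBall, dist_comm]
      exact h3.trans (le_abs_self _)⟩
  have h5 := (hB (mem_image_of_mem _ h4)).trans (le_abs_self B)
  have h6 := mul_le_mul_of_nonneg_left h5 (show 0 ≤ k₂ by linarith)
  linarith

/-- In a geodesic space, maps that do not stretch small distances too much are coarsely
Lipschitz. -/
lemma IsCAT0.dist_le_of_coarse {X Y : Type*} [MetricSpace X] [MetricSpace Y] (hX : IsCAT0 X)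
    {f : X → Y} {L : ℝ} (hL : 0 ≤ L) (hf : ∀ x y, dist x y ≤ 1 → dist (f x) (f y) ≤ L) (x y : X) :
    dist (f x) (f y) ≤ L * dist x y + L := by
  have key : ∀ n : ℕ, ∀ y, dist x y ≤ n → dist (f x) (f y) ≤ L * n := by
    intro n
    induction n with
    | zero =>
      intro y hy
      rw [Nat.cast_zero] at hy
      rw [dist_le_zero.1 hy]
      simp
    | succ n ih =>
      intro y hy
      obtain ⟨γ, ℓ, hγ⟩ := hX.geodesic x y
      rw [hγ.dist_eq] at hy
      push_cast at hy ⊢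
      have hs : max (ℓ - 1) 0 ≤ ℓ := max_le (by linarith) hγ.nonneg
      have h1 : dist x (γ (max (ℓ - 1) 0)) = max (ℓ - 1) 0 :=
        (hγ.initial ⟨le_max_right _ _, hs⟩).dist_eq
      have h2 := hγ.dist_of_le (le_max_right (ℓ - 1) 0) hs le_rfl
      rw [hγ.right] at h2
      have h3 := ih (γ (max (ℓ - 1) 0)) (by
        rw [h1]; exact max_le (by linarith) (Nat.cast_nonneg _))
      have h4 := hf (γ (max (ℓ - 1) 0)) y (by rw [h2]; linarith [le_max_left (ℓ - 1) 0])
      have h5 := dist_triangle (f x) (f (γ (max (ℓ - 1) 0))) (f y)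
      linarith
  have h1 := key ⌈dist x y⌉₊ y (Nat.le_ceil _)
  have h2 := mul_le_mul_of_nonneg_left (Nat.ceil_lt_add_one (dist_nonneg (x := x) (y := y))).le hL
  linarith

lemma ActsQuasiGeometrically.exists_near_orbit {G : Type*} [Group G] {X : Type*} [MetricSpace X]
    [MulAction G X] (h : ActsQuasiGeometrically G X) (o : X) :
    ∃ (A : ℝ) (g : X → G), 0 ≤ A ∧ ∀ x, dist (g x • o) x ≤ A := by
  obtain ⟨k, K, hq⟩ := h.quasiIsometric
  obtain ⟨C, hC, hcov⟩ := h.cocompact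
  obtain ⟨r, hr⟩ := hC.isBounded.subset_closedBall o
  choose g c hc hgc using hcov
  have hk := (hq 1).1.1
  have hK := (hq 1).1.2.1
  refine ⟨k * |r| + K, g, by positivity, fun x => ?_⟩
  have h1 := ((hq (g x)).1.2.2 o (c x)).2
  have h2 : dist o (c x) ≤ r := by rw [dist_comm]; exact hr (hc x)
  have h3 := mul_le_mul_of_nonneg_left (h2.trans (le_abs_self r)) (show 0 ≤ k by linarith)
  simp only [hgc] at h1
  linarith

/-- The Schwarz–Milnor lemma, for two actions of the same group. -/
theorem exists_coarseEquiv {G : Type*} [Group G] {X₁ : Type*} [MetricSpace X₁] [ProperSpace X₁]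
    [MulAction G X₁] {X₂ : Type*} [MetricSpace X₂] [ProperSpace X₂] [MulAction G X₂]
    (hX₁ : IsCAT0 X₁) (hX₂ : IsCAT0 X₂) (h₁ : ActsQuasiGeometrically G X₁)
    (h₂ : ActsQuasiGeometrically G X₂) (o₁ : X₁) (o₂ : X₂) :
    ∃ (L : ℝ) (Φ : X₁ → X₂) (Ψ : X₂ → X₁), IsCoarseEquiv L Φ Ψ := by
  obtain ⟨A₁, g₁, hA₁, hg₁⟩ := h₁.exists_near_orbit o₁
  obtain ⟨A₂, g₂, hA₂, hg₂⟩ := h₂.exists_near_orbit o₂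
  -- Points at distance at most 1 have chosen orbit points at distance at most $1+2A_1$. The map
  -- $\Phi$ sends $x$ to the orbit point of $o_2$ with the same group element.
  obtain ⟨T₁, hT₁, ht₁⟩ := exists_orbit_bound h₁ h₂ o₁ o₂ (1 + 2 * A₁)
  obtain ⟨T₂, hT₂, ht₂⟩ := exists_orbit_bound h₂ h₁ o₂ o₁ (1 + 2 * A₂)
  have hΦ := hX₁.dist_le_of_coarse (f := fun x => g₁ x • o₂) hT₁ fun x y hxy => ht₁ _ _ (by
    have h1 := dist_triangle4 (g₁ x • o₁) x y (g₁ y • o₁)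
    have h2 := hg₁ x
    have h3 := hg₁ y
    rw [dist_comm] at h3
    linarith)
  have hΨ := hX₂.dist_le_of_coarse (f := fun x => g₂ x • o₁) hT₂ fun x y hxy => ht₂ _ _ (by
    have h1 := dist_triangle4 (g₂ x • o₂) x y (g₂ y • o₂)
    have h2 := hg₂ x
    have h3 := hg₂ y
    rw [dist_comm] at h3
    linarith)
  refine ⟨1 + T₁ + T₂ + A₁ + A₂, fun x => g₁ x • o₂, fun x => g₂ x • o₁, by linarith,
    fun x y => ?_, fun x y => ?_, fun x => ?_, fun x => ?_⟩
  · have := mul_le_mul_of_nonneg_right (show T₁ ≤ 1 + T₁ + T₂ + A₁ + A₂ by linarith)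
      (dist_nonneg (x := x) (y := y))
    linarith [hΦ x y]
  · have := mul_le_mul_of_nonneg_right (show T₂ ≤ 1 + T₁ + T₂ + A₁ + A₂ by linarith)
      (dist_nonneg (x := x) (y := y))
    linarith [hΨ x y]
  · have h1 := ht₂ _ _ ((hg₂ (g₁ x • o₂)).trans (by linarith))
    have h2 := dist_triangle (g₂ (g₁ x • o₂) • o₁) (g₁ x • o₁) x
    linarith [hg₁ x]
  · have h1 := ht₁ _ _ ((hg₁ (g₂ x • o₁)).trans (by linarith))
    have h2 := dist_triangle (g₁ (g₂ x • o₁) • o₂) (g₂ x • o₂) x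
    linarith [hg₂ x]

end GroupActions

/-! ### Replacing coarse rays by continuous ones -/

section Approximation

variable {X : Type*} [MetricSpace X] {o : X}

/-- Coarse quasi-geodesic rays are at bounded distance from continuous ones, with constants that
depend only on the constants of the ray. -/
lemma IsCAT0.exists_qRay (hX : IsCAT0 X) {q Q D : ℝ} {f : ℝ≥0 → X} (hf : IsQIEmbedding q Q f)
    (hD : dist o (f 0) ≤ D) : ∃ α : QRay o, IsQIEmbedding q (Q + 4 * (q + Q + D)) α ∧
      ∀ t, dist (α t) (f t) ≤ 2 * (q + Q + D) := by
  have hD0 : 0 ≤ D := dist_nonneg.trans hD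
  obtain ⟨hq, hQ, hqi⟩ := hf
  set S : ℝ := q + Q + D with hS
  have hS0 : 0 ≤ S := by linarith
  set x : ℕ → X := fun n => if n = 0 then o else f n with hx
  have hxf : ∀ n : ℕ, dist (x n) (f n) ≤ D := fun n => by
    by_cases hn : n = 0
    · subst hn
      simpa [hx] using hD
    · simp only [hx, if_neg hn, dist_self]
      exact hD0
  have hxx : ∀ n : ℕ, dist (x n) (x (n + 1)) ≤ S := fun n => by
    have h1 := (hqi n (n + 1 : ℕ)).2
    have h2 : dist (n : ℝ≥0) ((n + 1 : ℕ) : ℝ≥0) = 1 := by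
      rw [NNReal.dist_eq]; simp
    have h3 : x (n + 1) = f (n + 1 : ℕ) := by simp [hx]
    have h4 := dist_triangle (x n) (f n) (f (n + 1 : ℕ))
    have h5 := hxf n
    rw [h3]
    rw [h2] at h1
    linarith
  choose γ ℓ hγ using fun n : ℕ => hX.geodesic (x n) (x (n + 1))
  have hℓ : ∀ n, ℓ n ≤ S := fun n => by rw [← (hγ n).dist_eq]; exact hxx n
  -- The values at integer times, with $o$ in place of $f(0)$, are joined by geodesics traversed in
  -- unit time; each has length at most $S$, so the path is $S$-Lipschitz.
  set a : ℝ≥0 → X := fun t => γ ⌊(t : ℝ)⌋₊ (((t : ℝ) - ⌊(t : ℝ)⌋₊) * ℓ ⌊(t : ℝ)⌋₊) with ha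
  have hpiece : ∀ n : ℕ, ∀ u v : ℝ, 0 ≤ u → u ≤ v → v ≤ 1 →
      dist (γ n (u * ℓ n)) (γ n (v * ℓ n)) ≤ S * (v - u) := fun n u v hu huv hv => by
    have hn := (hγ n).nonneg
    rw [(hγ n).dist_of_le (mul_nonneg hu hn) (mul_le_mul_of_nonneg_right huv hn)
      (mul_le_of_le_one_left hn hv), ← sub_mul, mul_comm]
    exact mul_le_mul_of_nonneg_right (hℓ n) (by linarith)
  have hfl : ∀ t : ℝ≥0, 0 ≤ (t : ℝ) - ⌊(t : ℝ)⌋₊ ∧ (t : ℝ) - ⌊(t : ℝ)⌋₊ ≤ 1 := fun t =>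
    ⟨by linarith [Nat.floor_le t.coe_nonneg], by linarith [Nat.lt_floor_add_one (t : ℝ)]⟩
  have hleft : ∀ t : ℝ≥0, dist (x ⌊(t : ℝ)⌋₊) (a t) ≤ S * (t - ⌊(t : ℝ)⌋₊) := fun t => by
    have h1 := hpiece ⌊(t : ℝ)⌋₊ 0 ((t : ℝ) - ⌊(t : ℝ)⌋₊) le_rfl (hfl t).1 (hfl t).2
    rwa [zero_mul, (hγ _).left, sub_zero] at h1
  have hright : ∀ t : ℝ≥0, dist (a t) (x (⌊(t : ℝ)⌋₊ + 1)) ≤ S * (⌊(t : ℝ)⌋₊ + 1 - t) :=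
    fun t => by
      have h1 := hpiece ⌊(t : ℝ)⌋₊ ((t : ℝ) - ⌊(t : ℝ)⌋₊) 1 (hfl t).1 (hfl t).2 le_rfl
      rw [one_mul, (hγ _).right] at h1
      exact h1.trans (le_of_eq (by ring))
  have hsteps : ∀ m n : ℕ, dist (x m) (x (m + n)) ≤ S * n := fun m n => by
    induction n with
    | zero => simp
    | succ n ih =>
      have h1 := dist_triangle (x m) (x (m + n)) (x (m + n + 1))
      have h2 := hxx (m + n)
      rw [← add_assoc]
      push_cast
      linarith
  have hlip : ∀ s t : ℝ≥0, s ≤ t → dist (a s) (a t) ≤ S * (t - s) := fun s t hst => by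
    have hst' : (s : ℝ) ≤ t := hst
    rcases (Nat.floor_mono hst').eq_or_lt with h | h
    · have h1 := hpiece ⌊(s : ℝ)⌋₊ ((s : ℝ) - ⌊(s : ℝ)⌋₊) ((t : ℝ) - ⌊(s : ℝ)⌋₊) (hfl s).1
        (by linarith) (by rw [h]; exact (hfl t).2)
      simp only [ha, ← h]
      exact h1.trans (le_of_eq (by ring))
    · obtain ⟨n, hn⟩ := Nat.exists_eq_add_of_lt h
      have h1 := hright s
      have h2 := hleft t
      have h3 := hsteps (⌊(s : ℝ)⌋₊ + 1) n
      have hn' : ⌊(t : ℝ)⌋₊ = ⌊(s : ℝ)⌋₊ + 1 + n := by omega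
      have h4 := dist_triangle4 (a s) (x (⌊(s : ℝ)⌋₊ + 1)) (x ⌊(t : ℝ)⌋₊) (a t)
      rw [← hn'] at h3
      have h5 : ((⌊(t : ℝ)⌋₊ : ℕ) : ℝ) = ⌊(s : ℝ)⌋₊ + 1 + n := by exact_mod_cast hn'
      rw [h5] at h2
      linarith
  have hcont : Continuous a := by
    refine (LipschitzWith.of_dist_le_mul (K := S.toNNReal) fun s t => ?_).continuous
    rw [NNReal.dist_eq, Real.coe_toNNReal _ hS0]
    rcases le_total s t with h | h
    · have h' : (s : ℝ) ≤ t := h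
      rw [abs_sub_comm, abs_of_nonneg (by linarith)]
      exact hlip s t h
    · have h' : (t : ℝ) ≤ s := h
      rw [abs_of_nonneg (by linarith), dist_comm]
      exact hlip t s h
  have hclose : ∀ t, dist (a t) (f t) ≤ 2 * S := fun t => by
    have h1 := hleft t
    have h2 := hxf ⌊(t : ℝ)⌋₊
    have h3 := (hqi (⌊(t : ℝ)⌋₊ : ℕ) t).2
    have h4 : dist ((⌊(t : ℝ)⌋₊ : ℕ) : ℝ≥0) t ≤ 1 := by
      rw [NNReal.dist_eq, NNReal.coe_natCast, abs_sub_comm, abs_of_nonneg (hfl t).1]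
      exact (hfl t).2
    have h5 := dist_triangle4 (a t) (x ⌊(t : ℝ)⌋₊) (f (⌊(t : ℝ)⌋₊ : ℕ)) (f t)
    rw [dist_comm (a t) (x _)] at h5
    have h6 := mul_le_mul_of_nonneg_left (hfl t).2 hS0
    have h7 := mul_le_mul_of_nonneg_left h4 (show 0 ≤ q by linarith)
    linarith
  have hqia : IsQIEmbedding q (Q + 4 * S) a := by
    refine ⟨hq, by linarith, fun s t => ?_⟩
    have h1 := hclose s
    have h2 := hclose t
    have h3 := hqi s t
    have h4 := dist_triangle4 (a s) (f s) (f t) (a t)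
    have h5 := dist_triangle4 (f s) (a s) (a t) (f t)
    rw [dist_comm (f t) (a t)] at h4
    rw [dist_comm (f s) (a s)] at h5
    constructor <;> linarith [h3.1, h3.2]
  refine ⟨⟨a, hcont, ?_, q, _, hqia⟩, hqia, hclose⟩
  simp [ha, (hγ 0).left, hx]

end Approximation

/-! ### Boundary classes and existence of gauge systems -/

section BoundaryClasses

variable {X : Type*} [MetricSpace X] {κ : SublinearFunction} {o : X}

/-- Near a given point only a compact initial part of the ray matters. Closedness provides nearest
points. -/
lemma QRay.isClosed_range (β : QRay o) : IsClosed (range β) := by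
  obtain ⟨q, Q, hq, hQ, h⟩ := β.quasi
  refine isClosed_of_closure_subset fun x hx => ?_
  set T : ℝ≥0 := (q * (dist o x + 1 + Q)).toNNReal with hT
  have hcpt : IsClosed (β '' Icc 0 T) := (isCompact_Icc.image β.continuous_toFun).isClosed
  have hmem : x ∈ closure (β '' Icc 0 T) := by
    rw [Metric.mem_closure_iff] at hx ⊢
    intro ε hε
    obtain ⟨_, ⟨t, rfl⟩, ht⟩ := hx (min ε 1) (lt_min hε one_pos)
    refine ⟨β t, ⟨t, ⟨zero_le, ?_⟩, rfl⟩, ht.trans_le (min_le_left _ _)⟩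
    have h1 := (h 0 t).1
    rw [β.start, NNReal.dist_eq, NNReal.coe_zero, zero_sub, abs_neg, NNReal.abs_eq] at h1
    have h2 := dist_triangle o x (β t)
    have h3 := ht.le.trans (min_le_right ε 1)
    have h4 : 1 / q * (t : ℝ) ≤ dist o x + 1 + Q := by linarith
    rw [one_div, inv_mul_le_iff₀ (by linarith)] at h4
    exact NNReal.le_toNNReal_of_coe_le h4
  rw [hcpt.closure_eq] at hmem
  exact image_subset_range _ _ hmem

namespace Boundary

lemma close_of_mem_rays {a : Boundary κ o} {α β : QRay o} (hα : α ∈ a.rays) (hβ : β ∈ a.rays) :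
    Close κ o (range α) (range β) :=
  Quotient.exact (s := fellowTravelSetoid κ o) (Eq.trans hα (Eq.symm hβ))

lemma mem_rays_of_close {a : Boundary κ o} {α β : QRay o} (hβ : β ∈ a.rays)
    (h : Close κ o (range α) (range β)) : α ∈ a.rays :=
  Eq.trans (Quotient.sound (s := fellowTravelSetoid κ o) h) hβ

lemma ext_of_mem_rays {a b : Boundary κ o} {α : QRay o} (ha : α ∈ a.rays) (hb : α ∈ b.rays) :
    a = b := Subtype.ext (Eq.trans (Eq.symm ha) hb)

lemma rays_nonempty (a : Boundary κ o) : a.rays.Nonempty := by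
  obtain ⟨β, -, hβ⟩ := a.2
  exact ⟨β, hβ⟩

/-- Only one ray of the class is known to be contracting; the Morse property, unlike contraction,
passes directly to sets close to it. -/
lemma coarselyMorse [ProperSpace X] {a : Boundary κ o} {α : QRay o} (hα : α ∈ a.rays) :
    CoarselyMorse κ o (range α) := by
  obtain ⟨β, hβ, hβa⟩ := a.2
  exact (hβ.coarselyMorse (nearest_nonempty β.isClosed_range (range_nonempty _))).congr
    (range_nonempty _) (range_nonempty _) (close_of_mem_rays hβa hα)

end Boundary

lemma QRay.mem_range (β : QRay o) : o ∈ range β := ⟨0, β.start⟩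

/-- The geodesic ray inherits the Morse property from its class. It is then contracting by the
CAT(0) condition, which is what a strong gauge needs. -/
theorem nonempty_gaugeSystem [ProperSpace X] (hX : IsCAT0 X) (κ : SublinearFunction) (o : X) :
    Nonempty (GaugeSystem κ o) := by
  have h : ∀ a : Boundary κ o, ∃ b : QRay o, b ∈ a.rays ∧ Isometry b ∧
      ∃ m, IsStrongMorseGauge κ o (range b) m := fun a => by
    obtain ⟨β, hβ⟩ := a.rays_nonempty
    obtain ⟨q, Q, hq⟩ := β.quasi
    have hM := Boundary.coarselyMorse hβ
    obtain ⟨b, hb, hc⟩ := exists_geodesic_ray hX hq hM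
    have hcon := hX.isContracting b.mem_range
      (hM.congr (range_nonempty _) (range_nonempty _) hc.symm)
    exact ⟨b, Boundary.mem_rays_of_close hβ hc, hb, hcon.exists_strongMorseGauge
      (nearest_nonempty b.isClosed_range (range_nonempty _)) b.mem_range⟩
  choose b hb hiso m hm using h
  exact ⟨⟨b, hb, hiso, m, hm⟩⟩

end BoundaryClasses

/-! ### Induced maps of boundaries and their continuity -/

section BoundaryMaps

variable {X Y : Type*} [MetricSpace X] [MetricSpace Y] {κ : SublinearFunction} {o : X} {o' : Y}
  {L : ℝ} {Φ : X → Y} {Ψ : Y → X}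

/-- `F` is the map of boundaries that is induced by `Φ`. -/
def IsInduced (Φ : X → Y) (F : Boundary κ o → Boundary κ o') : Prop :=
  ∀ a : Boundary κ o, ∀ β ∈ a.rays, ∀ β' ∈ (F a).rays, Close κ o' (Φ '' range β) (range β')

/-- The image of a ray may be discontinuous and miss the base-point, but it is Morse, so a geodesic
ray close to it represents the image class. -/
lemma IsCoarseEquiv.exists_induced [ProperSpace X] [ProperSpace Y] (hY : IsCAT0 Y)
    (h : IsCoarseEquiv L Φ Ψ) (κ : SublinearFunction) (o : X) (o' : Y) :
    ∃ F : Boundary κ o → Boundary κ o', IsInduced Φ F := by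
  have key : ∀ a : Boundary κ o, ∃ a' : Boundary κ o',
      ∀ β ∈ a.rays, ∀ β' ∈ a'.rays, Close κ o' (Φ '' range β) (range β') := fun a => by
    obtain ⟨β, hβ⟩ := a.rays_nonempty
    obtain ⟨q, Q, hq⟩ := β.quasi
    have hr : Φ '' range β = range fun t => Φ (β t) := (range_comp Φ β).symm
    have hne := range_nonempty β
    have hM : CoarselyMorse κ o' (range fun t => Φ (β t)) :=
      h.coarselyMorse hne (range_nonempty _) (Boundary.coarselyMorse hβ)
        (by rw [hr]; exact ⟨⟨0, subset_kNbhd le_rfl⟩, ⟨0, subset_kNbhd le_rfl⟩⟩)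
    obtain ⟨b, hb, hc⟩ := exists_geodesic_ray hY (h.isQIEmbedding hq) hM
    have hcon := hY.isContracting b.mem_range
      (hM.congr (range_nonempty _) (range_nonempty _) hc.symm)
    let a' : Boundary κ o' := ⟨Quotient.mk _ b, b, hcon, rfl⟩
    have hba' : b ∈ a'.rays := rfl
    refine ⟨a', fun α hα α' hα' => ?_⟩
    have h1 : Close κ o' (Φ '' range α) (Φ '' range β) :=
      h.close_image (range_nonempty α) hne (Boundary.close_of_mem_rays hα hβ)
    rw [← hr] at hc
    exact (h1.trans (hne.image Φ) hc.symm).trans (range_nonempty b)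
      (Boundary.close_of_mem_rays hba' hα')
  choose F hF using key
  exact ⟨F, hF⟩

lemma IsInduced.leftInverse (h : IsCoarseEquiv L Φ Ψ) {F : Boundary κ o → Boundary κ o'}
    {F' : Boundary κ o' → Boundary κ o} (hF : IsInduced Φ F) (hF' : IsInduced Ψ F') :
    Function.LeftInverse F' F := fun a => by
  obtain ⟨β, hβ⟩ := a.rays_nonempty
  obtain ⟨β', hβ'⟩ := (F a).rays_nonempty
  obtain ⟨β'', hβ''⟩ := (F' (F a)).rays_nonempty
  have h1 := h.close_symm (o := o) (range_nonempty β) (range_nonempty β') (hF a β hβ β' hβ')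
  have h2 := hF' (F a) β' hβ' β'' hβ''
  exact Boundary.ext_of_mem_rays (Boundary.mem_rays_of_close hβ''
    (h1.symm.trans ((range_nonempty β').image Ψ) h2)) hβ

/-- Induced maps are continuous. -/
theorem IsInduced.continuous (hX : IsCAT0 X) (h : IsCoarseEquiv L Φ Ψ)
    {F : Boundary κ o → Boundary κ o'} (hF : IsInduced Φ F)
    (μ : GaugeSystem κ o) (μ' : GaugeSystem κ o') :
    Continuous (X := μ.Space) (Y := μ'.Space) F := by
  refine continuous_def.2 fun W hW b hb => ?_
  obtain ⟨r', hr', hrW⟩ := hW (F b) hb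
  suffices hsuff : ∃ R : ℝ, 0 < R ∧ ∀ a ∈ μ.nbhd b R, F a ∈ μ'.nbhd (F b) r' by
    obtain ⟨R, hR, hRa⟩ := hsuff
    exact ⟨R, hR, fun a ha => hrW (hRa a ha)⟩
  have hL := h.one_le
  -- the constants of the pulled back quasi-geodesics
  set D : ℝ := dist o (Ψ o') with hD
  set q : ℝ := L * r' with hq
  set Q : ℝ := L * r' + 3 * L with hQ
  set S : ℝ := q + Q + D with hS
  set C : ℝ := 2 * S with hC
  have hC0 : 0 ≤ C := by positivity
  set m : ℝ := μ.gauge b q (Q + 4 * S) with hm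
  have hne := range_nonempty (μ.ray b)
  -- This $n$ must precede $R'$, which depends on it, and $R$ comes last. The constant $LC+L+L$
  -- bounds the distance from $\alpha'(t)$ to $\Phi(\alpha(t))$ by way of $\Phi(\Psi(\alpha'(t)))$.
  obtain ⟨n, hn⟩ := h.exists_kNbhd (κ := κ) (o := o) (o' := o') hne
    (hF b _ (μ.ray_mem b) _ (μ'.ray_mem (F b))).1 m (L * C + L + L)
  obtain ⟨R', hR', hstrong⟩ :=
    (μ'.gauge_spec (F b)).strong r' (max n 1) hr' (one_pos.trans_le (le_max_right _ _)) κ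
  obtain ⟨R, hRge, hR, hsmall⟩ := κ.exists_smallComparedTo m (D + (L * R' + L) + C + 1)
  refine ⟨R, hR, fun a ha q₁ Q₁ α' hα' hα'q hsm => ?_⟩
  -- Only the point of $\alpha'$ at radius $R'$ remains to be controlled.
  refine hstrong q₁ Q₁ α' hα'q hsm ?_
  -- the constants of `α'` are bounded in terms of `r'`
  have hgauge := (μ'.gauge_spec (F b)).max_le q₁ Q₁ hα'q.1 hα'q.2.1
  have hgr := κ.le_half_of_small hr' hsm
  have hq₁ : q₁ ≤ r' := by linarith [(le_max_left q₁ Q₁).trans hgauge]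
  have hQ₁ : Q₁ ≤ r' := by linarith [(le_max_right q₁ Q₁).trans hgauge]
  have hf := h.symm.isQIEmbedding (hα'q.weaken hq₁ hQ₁)
  obtain ⟨α, hαq, hαf⟩ := hX.exists_qRay (o := o) (D := D) hf (by rw [α'.start])
  -- `α` represents `a`
  have hαa : α ∈ a.rays := by
    obtain ⟨β, hβ⟩ := a.rays_nonempty
    have h1 := h.close_symm (o := o) (range_nonempty β) (range_nonempty α') (hF a β hβ α' hα')
    refine Boundary.mem_rays_of_close hβ (Close.trans ((range_nonempty α').image Ψ) ⟨⟨|C|, ?_⟩,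
      ⟨|C|, ?_⟩⟩ h1)
    · refine subset_kNbhd_of_bounded ?_
      rintro _ ⟨t, rfl⟩
      exact ⟨_, ⟨_, ⟨t, rfl⟩, rfl⟩, hαf t⟩
    · refine subset_kNbhd_of_bounded ?_
      rintro _ ⟨_, ⟨t, rfl⟩, rfl⟩
      exact ⟨_, ⟨t, rfl⟩, by rw [dist_comm]; exact hαf t⟩
  set t : ℝ≥0 := firstTime α' R' with ht
  -- Up to time $t$, $\alpha'$ has norm at most $R'$, hence $\alpha$ has norm less than $R$ by the
  -- choice of $R$.
  have htR : t ≤ firstTime α R := by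
    refine le_firstTime α hR.le fun u hu => ?_
    have h1 := norm_le_of_le_firstTime α' hR'.le hu
    have h2 := h.inv o' (α' u)
    have h3 := dist_triangle4 o (Ψ o') (Ψ (α' u)) (α u)
    have h4 := hαf u
    rw [dist_comm] at h4
    have h5 := mul_le_mul_of_nonneg_left h1 (show 0 ≤ L by linarith)
    linarith
  have h1 := ha q (Q + 4 * S) α hαa hαq hsmall ⟨t, ⟨zero_le, htR⟩, rfl⟩
  have h2 := hn _ h1 (α' t) (by
    have h3 := dist_triangle (α' t) (Φ (Ψ (α' t))) (Φ (α t))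
    have h4 := h.right (α' t)
    have h5 := h.map (Ψ (α' t)) (α t)
    have h6 := mul_le_mul_of_nonneg_left (hαf t) (show 0 ≤ L by linarith)
    rw [dist_comm] at h4
    rw [dist_comm (Ψ (α' t))] at h5
    linarith)
  have h3 := kNbhd_mono (le_max_left n 1) h2
  simp only [kNbhd, mem_ofPred_eq] at h3
  rwa [dist_firstTime α' hR'.le] at h3

end BoundaryMaps

end SublinMorse

theorem mainTheorem3 {G : Type*} [Group G]
    {X₁ : Type*} [MetricSpace X₁] [ProperSpace X₁] [MulAction G X₁]
    {X₂ : Type*} [MetricSpace X₂] [ProperSpace X₂] [MulAction G X₂]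
    (hX₁ : SublinMorse.IsCAT0 X₁) (hX₂ : SublinMorse.IsCAT0 X₂)
    (hG₁ : SublinMorse.ActsQuasiGeometrically G X₁)
    (hG₂ : SublinMorse.ActsQuasiGeometrically G X₂)
    (κ : SublinMorse.SublinearFunction) (o₁ : X₁) (o₂ : X₂) :
    Nonempty (SublinMorse.GaugeSystem κ o₁) ∧ Nonempty (SublinMorse.GaugeSystem κ o₂) ∧
    ∀ (μ₁ : SublinMorse.GaugeSystem κ o₁) (μ₂ : SublinMorse.GaugeSystem κ o₂),
      Nonempty (μ₁.Space ≃ₜ μ₂.Space) := by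
  refine ⟨SublinMorse.nonempty_gaugeSystem hX₁ κ o₁, SublinMorse.nonempty_gaugeSystem hX₂ κ o₂,
    fun μ₁ μ₂ => ?_⟩
  obtain ⟨L, Φ, Ψ, h⟩ := SublinMorse.exists_coarseEquiv hX₁ hX₂ hG₁ hG₂ o₁ o₂
  obtain ⟨F, hF⟩ := h.exists_induced hX₂ κ o₁ o₂
  obtain ⟨F', hF'⟩ := h.symm.exists_induced hX₁ κ o₂ o₁
  exact ⟨{ toFun := F
           invFun := F'
           left_inv := hF.leftInverse h hF'
           right_inv := hF'.leftInverse h.symm hF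
           continuous_toFun := hF.continuous hX₁ h μ₁ μ₂
           continuous_invFun := hF'.continuous hX₂ h.symm μ₂ μ₁ }⟩
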